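/- A signed graph $\Sigma=(G,\sigma)$ is a finite simple graph $G$ together with a map $\sigma:E(G)\to\{+1,-1\}$. Its adjacency matrix $A=A(\Sigma)$ has the entry $\sigma(ij)$ at $(i,j)$ if $i$ and $j$ are adjacent, and $0$ otherwise. Write $\chi(\Sigma;x)=\det(xI-A)$, and let $\Delta_\Sigma$ be the discriminant of $\chi(\Sigma;x)$. Two signed graphs $\Sigma_1,\Sigma_2$ are generalized cospectral if $\det(xI-A(\Sigma_1))=\det(xI-A(\Sigma_2))$ and $\det(xI-(J-I-A(\Sigma_1)))=\det(xI-(J-I-A(\Sigma_2)))$, where $J$ is the all-ones matrix. $\Sigma$ is determined by its generalized spectrum if every signed graph that is generalized cospectral with $\Sigma$ is isomorphic to $\Sigma$ (by a graph isomorphism that preserves the signs of the edges). **Theorem.** Let $\Sigma$ be a signed bipartite graph with $n$ vertices, and let $W=[e,Ae,\ldots,A^{n-1}e]$ be its walk matrix, where $e$ is the all-ones vector. Assume that $\Sigma$ is controllable ($\operatorname{rank}W=n$) or almost controllable ($\operatorname{rank}W=n-1$), and that the constant coefficient (if $n$ is even) or the linear coefficient (if $n$ is odd) of $\chi(\Sigma;x)$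 is $\pm1$. Then: 1. For every bipartition of the vertex set into classes $X$ and $Y$ (every edge joins $X$ to $Y$) with $|X|\le\lfloor n/2\rfloor$, the block $B$ of $A$ with rows indexed by $X$ and columns indexed by $Y$ satisfies $2^{-\lfloor n/2\rfloor}\sqrt{\Delta_\Sigma}=\Delta_{BB^{\mathsf T}}$, where $\Delta_{BB^{\mathsf T}}$ is the discriminant of the characteristic polynomial of $BB^{\mathsf T}$. In particular $2^{-\lfloor n/2\rfloor}\sqrt{\Delta_\Sigma}$ is an integer. 2. If the integer $2^{-\lfloor n/2\rfloor}\sqrt{\Delta_\Sigma}$ is squarefree, then it is odd and $\Sigma$ is determined by its generalized spectrum. -/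

import Mathlib

open Polynomial

universe u v

/-- A signed graph on the vertex set `V`: a simple graph with a map from its edge set to `{1, -1}`. -/
structure SignedGraph (V : Type u) where
  graph : SimpleGraph V
  sign : graph.edgeSet → ℤˣ

namespace SignedGraph

/-- Isomorphism of signed graphs: a graph isomorphism that preserves the sign of every edge. -/
def IsIsomorphic {V : Type u} {W : Type v} (S : SignedGraph V) (T : SignedGraph W) : Prop :=
  ∃ f : S.graph ≃g T.graph, ∀ e : S.graph.edgeSet, T.sign (f.mapEdgeSet e) = S.sign e

open Classical in
/-- The adjacency matrix: the sign of the edge `ij` if `i` and `j` are adjacent, else `0`. -/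
noncomputable def adjMatrix {V : Type u} (S : SignedGraph V) : Matrix V V ℤ :=
  Matrix.of fun i j =>
    if h : S.graph.Adj i j then ((S.sign ⟨s(i, j), S.graph.mem_edgeSet.mpr h⟩ : ℤˣ) : ℤ) else 0

section Finite

variable {V : Type u} [Fintype V] [DecidableEq V]

/-- The characteristic polynomial `det (xI - A)`. -/
noncomputable def charpoly (S : SignedGraph V) : ℤ[X] :=
  S.adjMatrix.charpoly

/-- The characteristic polynomial `det (xI - (J - I - A))` of the formal complement. -/
noncomputable def complCharpoly (S : SignedGraph V) : ℤ[X] :=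
  ((Matrix.of fun _ _ => 1) - 1 - S.adjMatrix : Matrix V V ℤ).charpoly

/-- The discriminant of the characteristic polynomial. -/
noncomputable def discr (S : SignedGraph V) : ℤ :=
  S.charpoly.discr

/-- The walk matrix `[e, Ae, …, A ^ (n - 1) e]`, with `e` the all-ones vector. -/
noncomputable def walkMatrix (S : SignedGraph V) : Matrix V (Fin (Fintype.card V)) ℤ :=
  Matrix.of fun i k => (S.adjMatrix ^ (k : ℕ)).mulVec (fun _ => 1) i

/-- The rank of the walk matrix, as a matrix over `ℚ`. -/
noncomputable def walkRank (S : SignedGraph V) : ℕ :=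
  (S.walkMatrix.map (Int.cast : ℤ → ℚ)).rank

/-- The walk matrix has rank `n`. -/
def IsControllable (S : SignedGraph V) : Prop :=
  S.walkRank = Fintype.card V

/-- The walk matrix has rank `n - 1`. -/
def IsAlmostControllable (S : SignedGraph V) : Prop :=
  S.walkRank + 1 = Fintype.card V

/-- The block `B` of the adjacency matrix with rows in `X` and columns outside `X`. -/
noncomputable def block (S : SignedGraph V) (X : Finset V) :
    Matrix {v // v ∈ X} {v // v ∉ X} ℤ :=
  S.adjMatrix.submatrix Subtype.val Subtype.val

/-- Two signed graphs are generalized cospectral if they have the same characteristic polynomial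
and so have their formal complements. -/
def GeneralizedCospectral {W : Type v} [Fintype W] [DecidableEq W]
    (S : SignedGraph V) (T : SignedGraph W) : Prop :=
  S.charpoly = T.charpoly ∧ S.complCharpoly = T.complCharpoly

end Finite

/-- `S` is determined by its generalized spectrum: every (finite) signed graph that is generalized
cospectral with `S` is isomorphic to `S`. -/
def IsDGS {V : Type u} [Fintype V] [DecidableEq V] (S : SignedGraph V) : Prop :=
  ∀ (W : Type v) [Fintype W] [DecidableEq W] (T : SignedGraph W),
    S.GeneralizedCospectral T → S.IsIsomorphic T

end SignedGraph

/-!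
Let `p` be the characteristic polynomial of `B Bᵀ`. Then `χ` is `p(x²)` or `x p(x²)` with
`p(0) = ±1`, whence `Δ_χ = 4 ^ ⌊n/2⌋ Δ_p ^ 2`. If `Δ_p` is squarefree, it is odd by Stickelberger,
and although `ℤ[x]/(χ)` need not be integrally closed, `a ^ 2 ∣ t ^ 2` still implies `a ∣ t` in it
for every integer `a`.

A generalized cospectral `A'` has the same walk moments `eᵀ A ^ k e`, so `A' = Q A Qᵀ` for a
rational orthogonal `Q` with `Q e = e`. A row `x` of `Q` has integral moments `xᵀ A ^ k x`.
Clear denominators, `y = N x`, and put `F = χ · yᵀ (X - A)⁻¹ eᵢ`. As the adjugate of `X - A` has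
rank one modulo `χ`, `F ^ 2` is congruent to `(χ · yᵀ (X - A)⁻¹ y) (χ · eᵢᵀ (X - A)⁻¹ eᵢ)`,
which is divisible by `N ^ 2`. Hence `N` divides `F` modulo `χ`, and so it divides `yᵢ`: the
matrix `Q` is integral, and an integral orthogonal matrix that fixes `e` is a permutation
matrix.
-/

section Discriminant

lemma discr_one {R : Type*} [CommRing R] : (1 : R[X]).discr = 1 := by
  rw [← C_1, discr_C]

lemma resultant_derivative_of_monic {R : Type*} [CommRing R] {f : R[X]} (hf : f.Monic)
    (hpos : 0 < f.natDegree) :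
    resultant f f.derivative f.natDegree (f.natDegree - 1) =
      (-1) ^ (f.natDegree * (f.natDegree - 1) / 2) * f.discr := by
  rw [resultant_deriv (natDegree_pos_iff_degree_pos.mp hpos), hf.leadingCoeff, mul_one]

lemma discr_map_of_monic {R S : Type*} [CommRing R] [CommRing S] [Nontrivial S] {f : R[X]}
    (hf : f.Monic) (φ : R →+* S) : (f.map φ).discr = φ f.discr := by
  have := φ.domain_nontrivial
  rcases Nat.eq_zero_or_pos f.natDegree with h0 | hpos
  · rw [hf.natDegree_eq_zero.mp h0, Polynomial.map_one, discr_one, discr_one, map_one]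
  have hdeg : (f.map φ).natDegree = f.natDegree := hf.natDegree_map φ
  have h := resultant_derivative_of_monic (hf.map φ) (hdeg ▸ hpos)
  rw [derivative_map, resultant_map_map, hdeg, resultant_derivative_of_monic hf hpos, map_mul,
    map_pow, map_neg, map_one] at h
  exact ((isUnit_one.neg.pow _).mul_left_cancel h).symm

lemma discr_eq_prod_eval_derivative {K : Type*} [Field K] {f : K[X]} (hf : f.Monic)
    (hs : f.Splits) :
    f.discr =
      (-1) ^ (f.natDegree * (f.natDegree - 1) / 2) * (f.roots.map f.derivative.eval).prod := by
  rcases Nat.eq_zero_or_pos f.natDegree with h0 | hpos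
  · simp [hf.natDegree_eq_zero.mp h0, discr_one]
  have h := resultant_eq_prod_eval f f.derivative (f.natDegree - 1) (natDegree_derivative_le _) hs
  rw [resultant_derivative_of_monic hf hpos, hf.leadingCoeff, one_pow, one_mul] at h
  rw [← h, ← mul_assoc, ← mul_pow, neg_one_mul, neg_neg, one_pow, one_mul]

lemma eval_derivative_prod_X_sub_C {ι R : Type*} [Fintype ι] [DecidableEq ι] [CommRing R]
    (r : ι → R) (k : ι) :
    (derivative (∏ i, (X - C (r i)))).eval (r k) = ∏ j ∈ {k}ᶜ, (r k - r j) := by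
  rw [derivative_prod_finset, eval_finsetSum, Finset.sum_eq_single k]
  · simp [eval_prod, Finset.compl_singleton]
  · intro i _ hi
    rw [eval_mul, eval_prod, Finset.prod_eq_zero (i := k) (by simp [hi.symm]) (by simp), zero_mul]
  · simp

lemma sum_card_Ioi_fin (m : ℕ) : ∑ i : Fin m, (Finset.Ioi i).card = m * (m - 1) / 2 := by
  simp only [Fin.card_Ioi]
  rw [← Finset.sum_range_id, ← Finset.sum_range_reflect, Finset.sum_range]

lemma discr_prod_X_sub_C {K : Type*} [Field K] {m : ℕ} (r : Fin m → K) :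
    (∏ i, (X - C (r i))).discr = (Matrix.vandermonde r).det ^ 2 := by
  have hmonic : (∏ i, (X - C (r i))).Monic := monic_prod_of_monic _ _ fun i _ => monic_X_sub_C _
  have hroots : (∏ i, (X - C (r i))).roots = Finset.univ.val.map r := by
    rw [roots_prod _ _ (Finset.prod_ne_zero_iff.mpr fun i _ => X_sub_C_ne_zero _)]
    simp only [roots_X_sub_C, Multiset.bind_singleton]
  have hdeg : (∏ i, (X - C (r i))).natDegree = m := by
    rw [natDegree_finsetProd_X_sub_C_eq_card, Finset.card_fin]
  rw [discr_eq_prod_eval_derivative hmonic (Splits.prod fun i _ => Splits.X_sub_C _), hdeg, hroots,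
    Multiset.map_map, Finset.prod_map_val]
  simp only [Function.comp_apply, eval_derivative_prod_X_sub_C]
  rw [← Finset.prod_prod_Ioi_mul_eq_prod_prod_off_diag fun i j => r j - r i, ← sum_card_Ioi_fin,
    ← Finset.prod_pow_eq_pow_sum, ← Finset.prod_mul_distrib, Matrix.det_vandermonde,
    ← Finset.prod_pow]
  refine Finset.prod_congr rfl fun i _ => ?_
  rw [← Finset.prod_pow, ← Finset.prod_const, ← Finset.prod_mul_distrib]
  exact Finset.prod_congr rfl fun j _ => by ring

lemma exists_eq_prod_X_sub_C {K : Type*} [Field K] {f : K[X]} (hf : f.Monic) (hs : f.Splits) :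
    ∃ r : Fin f.natDegree → K, f = ∏ i, (X - C (r i)) := by
  have hlen : f.natDegree = f.roots.toList.length := by
    rw [Multiset.length_toList, hs.natDegree_eq_card_roots]
  refine ⟨fun i => f.roots.toList[i.cast hlen], ?_⟩
  calc f = (f.roots.toList.map (X - C ·)).prod := by
        rw [Multiset.prod_map_toList]
        exact hs.eq_prod_roots_of_monic hf
    _ = ∏ i, (X - C f.roots.toList[i]) := (Fin.prod_univ_fun_getElem _ (X - C ·)).symm
    _ = ∏ i : Fin f.natDegree, (X - C f.roots.toList[i.cast hlen]) :=
        (Equiv.prod_comp (finCongr hlen) fun i => X - C f.roots.toList[i]).symm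

lemma discr_nonneg_of_splits {K : Type*} [Field K] [LinearOrder K] [IsStrictOrderedRing K]
    {f : K[X]} (hf : f.Monic) (hs : f.Splits) : 0 ≤ f.discr := by
  obtain ⟨r, hr⟩ := exists_eq_prod_X_sub_C hf hs
  rw [hr, discr_prod_X_sub_C]
  exact sq_nonneg _

lemma discr_charpoly_nonneg {ι : Type*} [Fintype ι] [DecidableEq ι] {M : Matrix ι ι ℤ}
    (hM : M.IsSymm) : 0 ≤ M.charpoly.discr := by
  have hA : (M.map (Int.castRingHom ℝ)).IsHermitian := by
    ext i j
    simp [hM.apply j i]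
  have hs : (M.charpoly.map (Int.castRingHom ℝ)).Splits :=
    M.charpoly_map (Int.castRingHom ℝ) ▸ hA.splits_charpoly
  have h := discr_nonneg_of_splits (M.charpoly_monic.map _) hs
  rwa [discr_map_of_monic M.charpoly_monic, eq_intCast, Int.cast_nonneg_iff] at h

lemma roots_expand_two {K : Type*} [Field K] {p : K[X]} (hp : p.Monic) (hs : p.Splits)
    {s : K → K} (hsq : ∀ z, s z ^ 2 = z) :
    (expand K 2 p).roots = p.roots.map s + p.roots.map fun z => -s z := by
  have h : expand K 2 p = ((p.roots.map s + p.roots.map fun z => -s z).map (X - C ·)).prod := by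
    conv_lhs => rw [hs.eq_prod_roots_of_monic hp]
    rw [map_multiset_prod, Multiset.map_map, Multiset.map_add, Multiset.prod_add, Multiset.map_map,
      Multiset.map_map, ← Multiset.prod_map_mul]
    refine congrArg Multiset.prod (Multiset.map_congr rfl fun z _ => ?_)
    simp only [Function.comp_apply, map_sub, expand_X, expand_C, C_neg]
    nth_rw 1 [← hsq z]
    rw [C_pow]
    ring
  rw [h, roots_multiset_prod_X_sub_C]

lemma discr_X_mul_of_splits {K : Type*} [Field K] {f : K[X]} (hf : f.Monic) (hs : f.Splits) :
    (X * f).discr = f.coeff 0 ^ 2 * f.discr := by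
  have hroots : (X * f).roots = {0} + f.roots := by
    rw [roots_mul (mul_ne_zero X_ne_zero hf.ne_zero), roots_X]
  have hzero : (X * f).derivative.eval 0 = f.coeff 0 := by
    simp [coeff_zero_eq_eval_zero]
  have hval : f.roots.map (X * f).derivative.eval =
      f.roots.map fun z => z * f.derivative.eval z :=
    Multiset.map_congr rfl fun z hz => by
      simp [show f.eval z = 0 from isRoot_of_mem_roots hz]
  have hsign : ((-1 : K)) ^ ((f.natDegree + 1) * f.natDegree / 2) =
      (-1) ^ (f.natDegree * (f.natDegree - 1) / 2) * (-1) ^ f.natDegree := by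
    rw [← pow_add, ← Nat.triangle_succ, Nat.add_sub_cancel]
  rw [discr_eq_prod_eval_derivative (monic_X.mul hf) (Splits.X.mul hs), hroots,
    natDegree_X_mul hf.ne_zero, Nat.add_sub_cancel, hsign, Multiset.map_add, Multiset.prod_add,
    Multiset.map_singleton, Multiset.prod_singleton, hzero, hval, Multiset.prod_map_mul,
    Multiset.map_id', discr_eq_prod_eval_derivative hf hs,
    hs.coeff_zero_eq_prod_roots_of_monic hf]
  ring

lemma discr_expand_two_of_isAlgClosed {K : Type*} [Field K] [IsAlgClosed K] {p : K[X]}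
    (hp : p.Monic) :
    (expand K 2 p).discr = (-4) ^ p.natDegree * p.coeff 0 * p.discr ^ 2 := by
  have hs := IsAlgClosed.splits p
  choose s hsq using fun z : K => IsAlgClosed.exists_pow_nat_eq z two_pos
  have hval : ∀ z, (expand K 2 p).derivative.eval (s z) * (expand K 2 p).derivative.eval (-s z) =
      (-4) * z * p.derivative.eval z ^ 2 := fun z => by
    simp only [derivative_expand, eval_mul, expand_eval, hsq, neg_sq, eval_ofNat,
      eval_X, Nat.cast_ofNat, Nat.add_one_sub_one, pow_one]
    linear_combination (-4) * (p.derivative.eval z ^ 2) * hsq z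
  have hsign : ((-1 : K)) ^ (p.natDegree * 2 * (p.natDegree * 2 - 1) / 2) = (-1) ^ p.natDegree := by
    rw [mul_right_comm, Nat.mul_div_cancel _ two_pos, mul_comm p.natDegree (_ - 1), pow_mul]
    rcases p.natDegree with - | m
    · simp
    · rw [Odd.neg_one_pow (n := (m + 1) * 2 - 1) ⟨m, by omega⟩]
  rw [discr_eq_prod_eval_derivative (hp.expand two_pos) (IsAlgClosed.splits _),
    roots_expand_two hp hs hsq, natDegree_expand, hsign, Multiset.map_add, Multiset.prod_add,
    Multiset.map_map, Multiset.map_map, ← Multiset.prod_map_mul]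
  simp only [Function.comp_apply, hval]
  rw [Multiset.prod_map_mul, Multiset.prod_map_mul, Multiset.map_const', Multiset.prod_replicate,
    Multiset.prod_map_pow, Multiset.map_id', ← hs.natDegree_eq_card_roots,
    hs.coeff_zero_eq_prod_roots_of_monic hp, discr_eq_prod_eval_derivative hp hs]
  have hsq1 : (((-1 : K)) ^ (p.natDegree * (p.natDegree - 1) / 2)) ^ 2 = 1 := by
    rw [← pow_mul, mul_comm, pow_mul, neg_one_sq, one_pow]
  rw [mul_pow, hsq1]
  ring

section Domain

variable {R : Type*} [CommRing R] [IsDomain R] {f : R[X]}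

lemma algebraMap_algebraicClosure_fractionRing_injective :
    Function.Injective (algebraMap R (AlgebraicClosure (FractionRing R))) := by
  rw [IsScalarTower.algebraMap_eq R (FractionRing R)]
  exact (algebraMap (FractionRing R) _).injective.comp (IsFractionRing.injective R _)

lemma discr_X_mul (hf : f.Monic) : (X * f).discr = f.coeff 0 ^ 2 * f.discr := by
  let φ := algebraMap R (AlgebraicClosure (FractionRing R))
  have h := discr_X_mul_of_splits (hf.map φ) (IsAlgClosed.splits _)
  rw [← Polynomial.map_X φ, ← Polynomial.map_mul, discr_map_of_monic (monic_X.mul hf),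
    discr_map_of_monic hf, coeff_map, ← map_pow, ← map_mul] at h
  exact algebraMap_algebraicClosure_fractionRing_injective h

lemma discr_expand_two (hf : f.Monic) :
    (expand R 2 f).discr = (-4) ^ f.natDegree * f.coeff 0 * f.discr ^ 2 := by
  let φ := algebraMap R (AlgebraicClosure (FractionRing R))
  have h := discr_expand_two_of_isAlgClosed (hf.map φ)
  rw [← map_expand, discr_map_of_monic (hf.expand two_pos), discr_map_of_monic hf, coeff_map,
    hf.natDegree_map, ← map_ofNat φ, ← map_neg, ← map_pow, ← map_pow, ← map_mul, ← map_mul] at h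
  exact algebraMap_algebraicClosure_fractionRing_injective h

end Domain

end Discriminant

lemma dvd_of_isIntegral_of_mul_eq {R K : Type*} [CommRing R] [IsDomain R] [IsIntegrallyClosed R]
    [Field K] [Algebra R K] [FaithfulSMul R K] {a b : R} {x : K} (hx : IsIntegral R x)
    (hb : b ≠ 0) (h : algebraMap R K b * x = algebraMap R K a) : b ∣ a := by
  let F := FractionRing R
  let ψ : F →ₐ[R] K := IsFractionRing.liftAlgHom (g := Algebra.ofId R K)
    (FaithfulSMul.algebraMap_injective R K)
  have hψ : ψ (algebraMap R F a / algebraMap R F b) = x := by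
    rw [map_div₀, ψ.commutes, ψ.commutes, div_eq_iff, ← h, mul_comm]
    rwa [Ne, FaithfulSMul.algebraMap_eq_zero_iff]
  rw [← hψ, isIntegral_algHom_iff ψ ψ.injective, IsIntegrallyClosed.isIntegral_iff] at hx
  obtain ⟨c, hc⟩ := hx
  refine ⟨c, IsFractionRing.injective R F ?_⟩
  rw [map_mul, hc, mul_div_cancel₀]
  rwa [Ne, FaithfulSMul.algebraMap_eq_zero_iff]

lemma exists_algebraMap_eq_aeval_of_isSymmetric {R A : Type*} [CommRing R] [CommRing A]
    [Algebra R A] {n : ℕ} {f : R[X]} {r : Fin n → A}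
    (hf : f.map (algebraMap R A) = ∏ i, (X - C (r i))) {P : MvPolynomial (Fin n) R}
    (hP : P.IsSymmetric) : ∃ s : R, algebraMap R A s = MvPolynomial.aeval r P := by
  have hesymm : ∀ i : Fin n, MvPolynomial.aeval r (MvPolynomial.esymm (Fin n) R (i + 1)) =
      algebraMap R A ((-1) ^ (i + 1 : ℕ) * f.coeff (n - (i + 1))) := fun i => by
    have hcard : Multiset.card (Finset.univ.val.map r) = n := by simp
    have h := Multiset.prod_X_sub_C_coeff (Finset.univ.val.map r) (k := n - (i + 1)) (by omega)
    rw [Multiset.map_map] at h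
    rw [MvPolynomial.aeval_esymm_eq_multiset_esymm, map_mul, ← coeff_map, hf, Finset.prod]
    simp only [Function.comp_def] at h
    rw [h, hcard, Nat.sub_sub_self i.2, map_pow, map_neg, map_one, ← mul_assoc, ← mul_pow,
      neg_one_mul, neg_neg, one_pow, one_mul]
  obtain ⟨Q, hQ⟩ := MvPolynomial.esymmAlgHom_surjective R (σ := Fin n) (Fintype.card_fin n).le
    ⟨P, hP⟩
  refine ⟨MvPolynomial.aeval (fun i : Fin n => (-1) ^ (i + 1 : ℕ) * f.coeff (n - (i + 1))) Q, ?_⟩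
  have hQ' : MvPolynomial.aeval (fun i : Fin n => MvPolynomial.esymm (Fin n) R (i + 1)) Q = P := by
    rw [← MvPolynomial.esymmAlgHom_apply, hQ]
  rw [← MvPolynomial.aeval_algebraMap_apply, ← hQ', ← AlgHom.comp_apply, MvPolynomial.comp_aeval]
  simp only [hesymm, Function.comp_def]

lemma permanent_vandermonde_isSymmetric (R : Type*) [CommRing R] (n : ℕ) :
    (Matrix.vandermonde (MvPolynomial.X (R := R) : Fin n → _)).permanent.IsSymmetric := by
  intro e
  conv_rhs => rw [← Matrix.permanent_permute_cols e]
  simp [Matrix.permanent, Matrix.vandermonde_apply]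

lemma aeval_permanent_vandermonde {R A : Type*} [CommRing R] [CommRing A] [Algebra R A] {n : ℕ}
    (r : Fin n → A) :
    MvPolynomial.aeval r (Matrix.vandermonde (MvPolynomial.X (R := R) : Fin n → _)).permanent =
      (Matrix.vandermonde r).permanent := by
  simp [Matrix.permanent, map_sum, map_prod, Matrix.vandermonde_apply]

lemma exists_isIntegral_det_eq_permanent_sub {R A ι : Type*} [CommRing R] [CommRing A]
    [Algebra R A] [Fintype ι] [DecidableEq ι] {M : Matrix ι ι A}
    (hM : ∀ i j, IsIntegral R (M i j)) :
    ∃ N, IsIntegral R N ∧ M.det = M.permanent - 2 * N := by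
  refine ⟨∑ σ : Equiv.Perm ι with Equiv.Perm.sign σ = -1, ∏ i, M (σ i) i,
    IsIntegral.sum _ fun σ _ => IsIntegral.prod _ fun i _ => hM _ _, ?_⟩
  rw [Matrix.det_apply, Matrix.permanent, Finset.mul_sum, Finset.sum_filter,
    ← Finset.sum_sub_distrib]
  refine Finset.sum_congr rfl fun σ _ => ?_
  rcases Int.units_eq_one_or (Equiv.Perm.sign σ) with h | h
  · simp [h]
  · rw [h, if_pos rfl, Units.neg_smul, one_smul]
    ring

lemma aeval_eq_zero_of_map_eq_prod_X_sub_C {R A ι : Type*} [CommRing R] [CommRing A] [Algebra R A]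
    [Fintype ι] {p : R[X]} {r : ι → A} (hr : p.map (algebraMap R A) = ∏ i, (X - C (r i)))
    (i : ι) : aeval (r i) p = 0 := by
  rw [← eval_map_algebraMap, hr, eval_prod]
  exact Finset.prod_eq_zero (Finset.mem_univ i) (by simp)

lemma isIntegral_adjugate_apply {R A ι : Type*} [CommRing R] [CommRing A] [Algebra R A]
    [Fintype ι] [DecidableEq ι] {M : Matrix ι ι A} (hM : ∀ i j, IsIntegral R (M i j)) (i j : ι) :
    IsIntegral R (M.adjugate i j) := by
  rw [Matrix.adjugate_apply]
  refine IsIntegral.det fun k l => ?_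
  rw [Matrix.updateRow_apply]
  split
  · rw [Pi.single_apply]
    split
    exacts [isIntegral_one, isIntegral_zero]
  · exact hM k l

lemma det_vandermonde_mul_coeff {R A : Type*} [CommRing R] [CommRing A] [Algebra R A] {n : ℕ}
    (r : Fin n → A) {f : R[X]} (hf : f.natDegree < n) (j : Fin n) :
    (Matrix.vandermonde r).det * algebraMap R A (f.coeff j) =
      ∑ i, (Matrix.vandermonde r).adjugate j i * aeval (r i) f := by
  have heval : (Matrix.vandermonde r).mulVec (fun i : Fin n => algebraMap R A (f.coeff i)) =
      fun i => aeval (r i) f := by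
    ext i
    rw [aeval_eq_sum_range' hf, Finset.sum_range]
    simp only [Matrix.mulVec, dotProduct, Matrix.vandermonde_apply, Algebra.smul_def, mul_comm]
  have h := congrFun (congrArg (Matrix.vandermonde r).adjugate.mulVec heval) j
  rwa [Matrix.mulVec_mulVec, Matrix.adjugate_mul, Matrix.smul_mulVec, Matrix.one_mulVec] at h

lemma exists_isIntegral_mul_eq_of_sq_eq {R K : Type*} [CommRing R] [Field K] [Algebra R K]
    {b x x' z z' : K} (hb : b ≠ 0) (hz : IsIntegral R z) (hz' : IsIntegral R z')
    (hx : x ^ 2 = b * z) (hx' : x' ^ 2 = b * z') : ∃ y, IsIntegral R y ∧ x * x' = b * y := by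
  refine ⟨x * x' / b, .of_pow two_pos ?_, (mul_div_cancel₀ _ hb).symm⟩
  have h : (x * x' / b) ^ 2 = z * z' := by
    rw [div_pow, mul_pow, hx, hx']
    field_simp
  exact h ▸ hz.mul hz'

lemma exists_map_eq_prod_X_sub_C_and_discr {R : Type*} [CommRing R] [IsDomain R] {p : R[X]}
    (hp : p.Monic) : ∃ r : Fin p.natDegree → AlgebraicClosure (FractionRing R),
      p.map (algebraMap R _) = ∏ i, (X - C (r i)) ∧
        algebraMap R _ p.discr = (Matrix.vandermonde r).det ^ 2 := by
  have h := exists_eq_prod_X_sub_C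
    (hp.map (algebraMap R (AlgebraicClosure (FractionRing R)))) (IsAlgClosed.splits _)
  rw [hp.natDegree_map] at h
  obtain ⟨r, hr⟩ := h
  exact ⟨r, hr, by rw [← discr_map_of_monic hp, hr, discr_prod_X_sub_C]⟩

section Integral

variable {R : Type*} [CommRing R] [IsDomain R] [IsIntegrallyClosed R] {p f : R[X]}

/-- Stickelberger's theorem. The witness `s` is the permanent of the Vandermonde matrix of the
roots, which is congruent to its determinant modulo `2`. -/
theorem exists_sq_sub_discr_eq_four_mul (hp : p.Monic) (h2 : (2 : R) ≠ 0) :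
    ∃ s t : R, s ^ 2 - p.discr = 4 * t := by
  let K := AlgebraicClosure (FractionRing R)
  have : FaithfulSMul R K := (faithfulSMul_iff_algebraMap_injective R K).mpr
    algebraMap_algebraicClosure_fractionRing_injective
  obtain ⟨r, hr, hdisc⟩ := exists_map_eq_prod_X_sub_C_and_discr hp
  obtain ⟨s, hs⟩ := exists_algebraMap_eq_aeval_of_isSymmetric hr
    (permanent_vandermonde_isSymmetric R _)
  rw [aeval_permanent_vandermonde] at hs
  have hroot (i) : IsIntegral R (r i) := ⟨p, hp, aeval_eq_zero_of_map_eq_prod_X_sub_C hr i⟩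
  obtain ⟨N, hN, hdet⟩ := exists_isIntegral_det_eq_permanent_sub (R := R)
    (M := Matrix.vandermonde r) fun i j => (hroot i).pow j
  rw [hdet, ← hs] at hdisc
  have hint : IsIntegral R (N * (algebraMap R K s - N)) := hN.mul (isIntegral_algebraMap.sub hN)
  obtain ⟨t, ht⟩ := dvd_of_isIntegral_of_mul_eq (a := s ^ 2 - p.discr) (b := 4) hint
    (by rw [show (4 : R) = 2 * 2 by norm_num]; exact mul_ne_zero h2 h2)
    (by rw [map_sub, hdisc, map_pow, map_ofNat]; ring)
  exact ⟨s, t, ht⟩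

/- Cramer's rule for the Vandermonde system `∑ j, fⱼ rᵢ ^ j = f(rᵢ)` over the roots `rᵢ` of `p`;
the products `f(rᵢ) f(rₗ)` are integral multiples of `a`. -/
theorem dvd_sq_coeff_mul_discr (hp : p.Monic) {a : R} {g h : R[X]} (ha : a ≠ 0)
    (hdeg : f.natDegree < p.natDegree) (hf : f ^ 2 = p * g + C a * h) (j : ℕ) :
    a ∣ f.coeff j ^ 2 * p.discr := by
  have : FaithfulSMul R (AlgebraicClosure (FractionRing R)) :=
    (faithfulSMul_iff_algebraMap_injective R _).mpr
      algebraMap_algebraicClosure_fractionRing_injective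
  obtain hj | hj := le_or_gt p.natDegree j
  · simp [coeff_eq_zero_of_natDegree_lt (hdeg.trans_le hj)]
  obtain ⟨r, hr, hdisc⟩ := exists_map_eq_prod_X_sub_C_and_discr hp
  have hroot (i) := aeval_eq_zero_of_map_eq_prod_X_sub_C hr i
  have hint (i) : IsIntegral R (r i) := ⟨p, hp, hroot i⟩
  have hsq (i) : aeval (r i) f ^ 2 = algebraMap R _ a * aeval (r i) h := by
    rw [← map_pow, hf, map_add, map_mul, hroot, zero_mul, zero_add, map_mul, aeval_C]
  choose y hy hfy using fun i l => exists_isIntegral_mul_eq_of_sq_eq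
    ((FaithfulSMul.algebraMap_eq_zero_iff R _).not.mpr ha)
    (IsIntegral.of_mem_of_fg _ (hint i).fg_adjoin_singleton _ (aeval_mem_adjoin_singleton R (r i)))
    (IsIntegral.of_mem_of_fg _ (hint l).fg_adjoin_singleton _ (aeval_mem_adjoin_singleton R (r l)))
    (hsq i) (hsq l)
  let N := (Matrix.vandermonde r).adjugate
  have hN := isIntegral_adjugate_apply (M := Matrix.vandermonde r) fun i l => (hint i).pow l
  let k : Fin p.natDegree := ⟨j, hj⟩
  refine dvd_of_isIntegral_of_mul_eq (x := ∑ i, ∑ l, N k i * N k l * y i l)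
    (.sum _ fun i _ => .sum _ fun l _ => ((hN k i).mul (hN k l)).mul (hy i l)) ha ?_
  calc algebraMap R _ a * ∑ i, ∑ l, N k i * N k l * y i l
      = ∑ i, ∑ l, N k i * aeval (r i) f * (N k l * aeval (r l) f) := by
        simp only [Finset.mul_sum]
        refine Finset.sum_congr rfl fun i _ => Finset.sum_congr rfl fun l _ => ?_
        linear_combination - (N k i * N k l) * hfy i l
    _ = ((Matrix.vandermonde r).det * algebraMap R _ (f.coeff j)) ^ 2 := by
        rw [det_vandermonde_mul_coeff r hdeg k, sq, Finset.sum_mul_sum]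
    _ = algebraMap R _ (f.coeff j ^ 2 * p.discr) := by
        rw [map_mul, map_pow, hdisc, mul_pow, mul_comm]

end Integral

/-- Divisibility by `a` can be tested on squares. For the integers inside `ℤ[X] ⧸ (χ)` this is the
trace that the integral closedness of this ring leaves at the primes dividing `a`. -/
def ReflectsSqDvd {S : Type*} [CommMonoid S] (a : S) : Prop :=
  ∀ t : S, a ^ 2 ∣ t ^ 2 → a ∣ t

lemma ReflectsSqDvd.mul {S : Type*} [CommMonoid S] {a b : S} (ha : ReflectsSqDvd a)
    (hb : ReflectsSqDvd b) (hreg : IsLeftRegular a) : ReflectsSqDvd (a * b) := by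
  rintro t ⟨s, hs⟩
  obtain ⟨t, rfl⟩ := ha t ⟨b ^ 2 * s, by rw [hs, mul_pow, mul_assoc]⟩
  refine mul_dvd_mul_left a (hb t ⟨s, hreg.pow 2 ?_⟩)
  simpa only [mul_pow, mul_assoc] using hs

lemma of_dvd_mk_iff {R : Type*} [CommRing R] {p f : R[X]} {c : R} :
    AdjoinRoot.of p c ∣ AdjoinRoot.mk p f ↔ ∃ g h, f = p * g + C c * h := by
  rw [← AdjoinRoot.mk_C]
  constructor
  · rintro ⟨s, hs⟩
    obtain ⟨h, rfl⟩ := AdjoinRoot.mk_surjective s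
    rw [← map_mul, AdjoinRoot.mk_eq_mk] at hs
    obtain ⟨g, hg⟩ := hs
    exact ⟨g, h, by rw [← hg, sub_add_cancel]⟩
  · rintro ⟨g, h, rfl⟩
    exact ⟨AdjoinRoot.mk p h, by simp⟩

lemma isLeftRegular_of {R : Type*} [CommRing R] [IsDomain R] {p : R[X]} (hp : p.Monic) {c : R}
    (hc : c ≠ 0) : IsLeftRegular (AdjoinRoot.of p c) := by
  have : Module.Free R (AdjoinRoot p) := hp.free_adjoinRoot
  intro s t h
  refine smul_right_injective (AdjoinRoot p) hc ?_
  simpa only [Algebra.smul_def, AdjoinRoot.algebraMap_eq] using h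

section Integral

variable {R : Type*} [CommRing R] [IsDomain R] [IsIntegrallyClosed R] {p : R[X]}

lemma of_dvd_of_of_dvd_sq (hp : p.Monic) {a q : R} (ha : a ≠ 0)
    (hq : ∀ c, a ∣ c ^ 2 * p.discr → q ∣ c) {t : AdjoinRoot p}
    (ht : AdjoinRoot.of p a ∣ t ^ 2) : AdjoinRoot.of p q ∣ t := by
  obtain ⟨f, rfl⟩ := AdjoinRoot.mk_surjective t
  rcases eq_or_ne p 1 with rfl | h1
  · exact of_dvd_mk_iff.mpr ⟨f, 0, by simp⟩
  have hmk : AdjoinRoot.mk p f = AdjoinRoot.mk p (f %ₘ p) :=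
    AdjoinRoot.mk_eq_mk.mpr (dvd_sub_comm.mp (dvd_modByMonic_sub f p))
  rw [hmk] at ht ⊢
  rw [← map_pow, of_dvd_mk_iff] at ht
  obtain ⟨g, h, hgh⟩ := ht
  rw [← AdjoinRoot.mk_C]
  refine map_dvd _ (C_dvd_iff_dvd_coeff _ _ |>.mpr fun j => hq _ ?_)
  exact dvd_sq_coeff_mul_discr hp ha (natDegree_modByMonic_lt f hp h1) hgh j

variable {q : R} (hq : Prime q)

include hq

lemma of_dvd_of_dvd_sq_of_not_dvd_discr (hp : p.Monic) (hd : ¬ q ∣ p.discr)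
    {t : AdjoinRoot p} (ht : AdjoinRoot.of p q ∣ t ^ 2) : AdjoinRoot.of p q ∣ t :=
  of_dvd_of_of_dvd_sq hp hq.ne_zero
    (fun _ h => hq.dvd_of_dvd_pow ((hq.dvd_or_dvd h).resolve_right hd)) ht

theorem reflectsSqDvd_of (hp : p.Monic) (hd : ¬ q ^ 2 ∣ p.discr) :
    ReflectsSqDvd (AdjoinRoot.of p q) := by
  intro t ht
  rw [← map_pow] at ht
  refine of_dvd_of_of_dvd_sq hp (pow_ne_zero 2 hq.ne_zero) (fun c h => ?_) ht
  by_contra hc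
  exact hd (hq.pow_dvd_of_dvd_mul_left 2 (fun h' => hc (hq.dvd_of_dvd_pow h')) h)

end Integral

section Quadratic

variable {S : Type*} [CommRing S] {a b y : S}

lemma two_dvd_of_sq_dvd_add_mul_sq (hreg : IsLeftRegular (2 : S))
    (hred : ∀ t : S, 2 ∣ t ^ 2 → 2 ∣ t) (h1 : (2 : S) ^ 2 ∣ a ^ 2 + y * b ^ 2)
    (h2 : (2 : S) ^ 2 ∣ 2 * (a * b)) : 2 ∣ a := by
  obtain ⟨s, hs⟩ := h1
  obtain ⟨r, hr⟩ := h2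
  have hab : a * b = 2 * r := hreg (by linear_combination hr)
  refine hred _ (hred _ ⟨2 * (s * a ^ 2 - y * r ^ 2), ?_⟩)
  linear_combination a ^ 2 * hs - y * (a * b + 2 * r) * hab

/-- The witness is `2 a ^ 2 - q ^ 2 s`, whose square is divisible by `q ^ 4`. -/
lemma ReflectsSqDvd.dvd_of_sq_dvd_add_mul_sq {q : S} (hq : ReflectsSqDvd q)
    (hreg : IsLeftRegular q) (hodd : Odd q) (h1 : q ^ 2 ∣ a ^ 2 + y * b ^ 2)
    (h2 : q ^ 2 ∣ 2 * (a * b)) : q ∣ a := by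
  have hcop : IsCoprime (q ^ 2) 2 := by
    obtain ⟨k, rfl⟩ := hodd
    exact ⟨1, -(2 * k ^ 2 + 2 * k), by ring⟩
  obtain ⟨s, hs⟩ := h1
  obtain ⟨c, hc⟩ := hcop.dvd_of_dvd_mul_left h2
  obtain ⟨u, hu⟩ := (hq.mul hq hreg) (2 * a ^ 2 - q ^ 2 * s)
    ⟨s ^ 2 - 4 * y * c ^ 2, by
      linear_combination 4 * a ^ 2 * hs - 4 * y * (a * b + q ^ 2 * c) * hc⟩
  exact hq a (hcop.dvd_of_dvd_mul_left ⟨u + s, by linear_combination hu⟩)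

lemma ReflectsSqDvd.dvd_of_dvd_of_sq_dvd_add_mul_sq {q : S} (hq : ReflectsSqDvd q) (hy : IsUnit y)
    (ha : q ∣ a) (h1 : q ^ 2 ∣ a ^ 2 + y * b ^ 2) : q ∣ b :=
  hq b (hy.dvd_mul_left.mp ((dvd_add_right (pow_dvd_pow_of_dvd ha 2)).mp h1))

end Quadratic

lemma exists_eq_expand_add_X_mul_expand {R : Type*} [CommRing R] (f : R[X]) :
    ∃ a b : R[X], f = expand R 2 a + X * expand R 2 b := by
  induction f using Polynomial.induction_on' with
  | add f g hf hg =>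
    obtain ⟨a, b, rfl⟩ := hf
    obtain ⟨c, d, rfl⟩ := hg
    exact ⟨a + c, b + d, by simp only [map_add]; ring⟩
  | monomial n r =>
    rcases Nat.even_or_odd' n with ⟨k, rfl | rfl⟩
    · exact ⟨monomial k r, 0, by simp [expand_monomial, mul_comm]⟩
    · refine ⟨0, monomial k r, ?_⟩
      rw [map_zero, zero_add, expand_monomial, X_mul_monomial, mul_comm]

lemma contract_two_X_mul_expand {R : Type*} [CommRing R] (f : R[X]) :
    contract 2 (X * expand R 2 f) = 0 := by
  ext k
  rw [coeff_contract two_ne_zero, coeff_zero]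
  cases k with
  | zero => simp
  | succ k =>
    rw [show (k + 1) * 2 = 2 * k + 1 + 1 by ring, coeff_X_mul, coeff_expand two_pos,
      if_neg (by omega)]

lemma expand_add_X_mul_expand_inj {R : Type*} [CommRing R] {a b c d : R[X]}
    (h : expand R 2 a + X * expand R 2 b = expand R 2 c + X * expand R 2 d) :
    a = c ∧ b = d := by
  have hac : a = c := by
    have := congrArg (contract 2) h
    simpa only [contract_add two_ne_zero, contract_expand 2 two_ne_zero,
      contract_two_X_mul_expand, add_zero] using this
  refine ⟨hac, expand_injective two_pos (isRegular_X.left ?_)⟩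
  rwa [hac, add_right_inj] at h

lemma isUnit_root {R : Type*} [CommRing R] {p : R[X]} (h0 : IsUnit (p.coeff 0)) :
    IsUnit (AdjoinRoot.root p) := by
  have h := congrArg (AdjoinRoot.mk p) (divX_mul_X_add p)
  rw [AdjoinRoot.mk_self, map_add, map_mul, AdjoinRoot.mk_X, AdjoinRoot.mk_C] at h
  refine isUnit_of_mul_isUnit_right (x := AdjoinRoot.mk p p.divX) ?_
  rw [eq_neg_of_add_eq_zero_left h]
  exact (h0.map _).neg

lemma not_two_dvd_discr {p : ℤ[X]} (hp : p.Monic) (hd : ¬ (2 : ℤ) ^ 2 ∣ p.discr) :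
    ¬ 2 ∣ p.discr := by
  obtain ⟨s, t, hst⟩ := exists_sq_sub_discr_eq_four_mul hp two_ne_zero
  intro h2
  have hs : 2 ∣ s := Int.prime_two.dvd_of_dvd_pow (n := 2) (by omega)
  have := pow_dvd_pow_of_dvd hs 2
  omega

lemma of_dvd_mk_expand_iff {R : Type*} [CommRing R] {p a b : R[X]} {c : R} :
    AdjoinRoot.of (expand R 2 p) c ∣ AdjoinRoot.mk _ (expand R 2 a + X * expand R 2 b) ↔
      AdjoinRoot.of p c ∣ AdjoinRoot.mk p a ∧ AdjoinRoot.of p c ∣ AdjoinRoot.mk p b := by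
  simp only [of_dvd_mk_iff]
  constructor
  · rintro ⟨g, h, hgh⟩
    obtain ⟨g0, g1, rfl⟩ := exists_eq_expand_add_X_mul_expand g
    obtain ⟨h0, h1, rfl⟩ := exists_eq_expand_add_X_mul_expand h
    obtain ⟨ha, hb⟩ := expand_add_X_mul_expand_inj (a := a) (b := b)
      (c := p * g0 + C c * h0) (d := p * g1 + C c * h1) (by
        simp only [map_add, map_mul, expand_C]
        linear_combination hgh)
    exact ⟨⟨g0, h0, ha⟩, ⟨g1, h1, hb⟩⟩
  · rintro ⟨⟨g0, h0, rfl⟩, ⟨g1, h1, rfl⟩⟩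
    refine ⟨expand R 2 g0 + X * expand R 2 g1, expand R 2 h0 + X * expand R 2 h1, ?_⟩
    simp only [map_add, map_mul, expand_C]
    ring

theorem reflectsSqDvd_of_expand_two {p : ℤ[X]} (hp : p.Monic) (h0 : IsUnit (p.coeff 0)) {q : ℕ}
    (hq : q.Prime) (hd : ¬ (q : ℤ) ^ 2 ∣ p.discr) :
    ReflectsSqDvd (AdjoinRoot.of (expand ℤ 2 p) q) := by
  intro t ht
  obtain ⟨f, rfl⟩ := AdjoinRoot.mk_surjective t
  obtain ⟨a, b, rfl⟩ := exists_eq_expand_add_X_mul_expand f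
  have hsq : (expand ℤ 2 a + X * expand ℤ 2 b) ^ 2 =
      expand ℤ 2 (a ^ 2 + X * b ^ 2) + X * expand ℤ 2 (2 * (a * b)) := by
    simp only [map_add, map_mul, map_pow, expand_X, map_ofNat]
    ring
  rw [← map_pow, ← map_pow, hsq, of_dvd_mk_expand_iff] at ht
  simp only [map_add, map_mul, map_pow, map_ofNat, AdjoinRoot.mk_X] at ht
  have hI := reflectsSqDvd_of (Nat.prime_iff_prime_int.mp hq) hp hd
  have hreg := isLeftRegular_of hp (Int.natCast_ne_zero.mpr hq.ne_zero)
  have ha : AdjoinRoot.of p q ∣ AdjoinRoot.mk p a := by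
    rcases hq.eq_two_or_odd' with rfl | hodd
    · have hred (t : AdjoinRoot p) := of_dvd_of_dvd_sq_of_not_dvd_discr (t := t)
        Int.prime_two hp (not_two_dvd_discr hp hd)
      simp only [Nat.cast_ofNat, map_ofNat] at *
      exact two_dvd_of_sq_dvd_add_mul_sq hreg hred ht.1 ht.2
    · refine hI.dvd_of_sq_dvd_add_mul_sq hreg ?_ ht.1 ht.2
      simpa using hodd.natCast (R := AdjoinRoot p)
  exact of_dvd_mk_expand_iff.mpr
    ⟨ha, hI.dvd_of_dvd_of_sq_dvd_add_mul_sq (isUnit_root h0) ha ht.1⟩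

theorem ReflectsSqDvd.of_X_mul {R : Type*} [CommRing R] {χ : R[X]} {q : R} (hq : Prime q)
    (hχ : ReflectsSqDvd (AdjoinRoot.of χ q)) (h0 : IsUnit (χ.coeff 0)) :
    ReflectsSqDvd (AdjoinRoot.of (X * χ) q) := by
  intro t ht
  obtain ⟨f, rfl⟩ := AdjoinRoot.mk_surjective t
  rw [← map_pow, ← map_pow, of_dvd_mk_iff] at ht
  obtain ⟨g, h, hf⟩ := ht
  obtain ⟨g1, h1, rfl⟩ := of_dvd_mk_iff.mp (hχ (AdjoinRoot.mk χ f) (by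
    rw [← map_pow, ← map_pow]
    exact of_dvd_mk_iff.mpr ⟨X * g, h, by rw [hf]; ring⟩))
  have hdvd : q ∣ g1.coeff 0 := by
    have e := congrArg (coeff · 0) hf
    simp only [coeff_zero_eq_eval_zero, eval_pow, eval_add, eval_mul, eval_X, zero_mul, zero_add,
      eval_C] at e
    have h2 : q ∣ eval 0 χ * eval 0 g1 + q * eval 0 h1 :=
      hq.dvd_of_dvd_pow (n := 2) ⟨q * eval 0 h, by rw [e]; ring⟩
    rw [coeff_zero_eq_eval_zero] at h0 ⊢
    exact h0.dvd_mul_left.mp ((dvd_add_left (dvd_mul_right q _)).mp h2)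
  obtain ⟨c, hc⟩ := hdvd
  have hg1 := divX_mul_X_add g1
  rw [hc, C_mul] at hg1
  refine of_dvd_mk_iff.mpr ⟨g1.divX, χ * C c + h1, ?_⟩
  linear_combination - χ * hg1

theorem reflectsSqDvd_of_forall_prime {p : ℤ[X]} (hp : p.Monic)
    (h : ∀ q : ℕ, q.Prime → ReflectsSqDvd (AdjoinRoot.of p q)) {a : ℤ} (ha : a ≠ 0) :
    ReflectsSqDvd (AdjoinRoot.of p a) := by
  have hnat (N : ℕ) (hN : N ≠ 0) : ReflectsSqDvd (AdjoinRoot.of p N) := by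
    induction N using induction_on_primes with
    | zero => exact absurd rfl hN
    | one => exact fun t _ => by simp
    | prime_mul q N hq ih =>
      rw [Nat.cast_mul, map_mul]
      exact (h q hq).mul (ih (right_ne_zero_of_mul hN))
        (isLeftRegular_of hp (Int.natCast_ne_zero.mpr hq.ne_zero))
  obtain ⟨N, rfl | rfl⟩ := a.eq_nat_or_neg
  · exact hnat N (by simpa using ha)
  · intro t
    rw [map_neg, neg_sq, neg_dvd]
    exact hnat N (by simpa using ha) t

section ResolventForm

open Matrix

variable {ι κ R : Type*} [Fintype ι] [DecidableEq ι] [Fintype κ] [DecidableEq κ] [CommRing R]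

lemma det_fromBlocks_mul_det_pow (N : Matrix ι ι R) (B : Matrix ι κ R) (D : Matrix κ ι R)
    (E : Matrix κ κ R) : (fromBlocks N B D E).det * N.det ^ Fintype.card κ =
      N.det * (N.det • E - D * N.adjugate * B).det := by
  have h : fromBlocks N B D E * fromBlocks 1 (-(N.adjugate * B)) 0 (N.det • 1) =
      fromBlocks N 0 D (N.det • E - D * N.adjugate * B) := by
    rw [fromBlocks_multiply]
    congr 1
    · simp
    · rw [Matrix.mul_neg, ← Matrix.mul_assoc, mul_adjugate]
      simp
    · simp
    · simp [Matrix.mul_assoc, sub_eq_neg_add]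
  simpa [det_mul, det_fromBlocks_zero₂₁, det_fromBlocks_zero₁₂] using congrArg det h

lemma det_add_vecMulVec_of_isLeftRegular {N : Matrix ι ι R} (hN : IsLeftRegular N.det)
    (x y : ι → R) : (N + vecMulVec x y).det = N.det + y ⬝ᵥ N.adjugate *ᵥ x := by
  have h := det_fromBlocks_mul_det_pow N (-replicateCol Unit x) (replicateRow Unit y) 1
  have hentry : (N.det • 1 - replicateRow Unit y * N.adjugate * -replicateCol Unit x).det =
      N.det + y ⬝ᵥ N.adjugate *ᵥ x := by
    rw [det_unique, Matrix.mul_neg, sub_neg_eq_add, Matrix.mul_assoc, ← replicateCol_mulVec]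
    simp [Matrix.mul_apply, dotProduct]
  rw [hentry, det_fromBlocks_one₂₂, Matrix.neg_mul, sub_neg_eq_add, Fintype.card_unit, pow_one,
    mul_comm, ← vecMulVec_eq] at h
  exact hN h

lemma det_add_vecMulVec (N : Matrix ι ι R) (x y : ι → R) :
    (N + vecMulVec x y).det = N.det + y ⬝ᵥ N.adjugate *ᵥ x := by
  let ev : R[X] →+* R := evalRingHom 0
  have hC (z : ι → R) : ev ∘ (C ∘ z) = z := by
    ext
    simp [ev]
  have hN : ev.mapMatrix (charmatrix (-N)) = N := by
    ext i j
    by_cases hij : i = j <;> simp [ev, hij]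
  have hvec : ev.mapMatrix (vecMulVec (C ∘ x) (C ∘ y)) = vecMulVec x y := by
    ext i j
    simp [ev, vecMulVec_apply]
  have h := congrArg ev <| det_add_vecMulVec_of_isLeftRegular
    (-N).charpoly_monic.isRegular.left (C ∘ x) (C ∘ y)
  rw [map_add, RingHom.map_det, RingHom.map_det, map_add, hvec, hN, RingHom.map_dotProduct] at h
  rw [h]
  congr 2
  · exact hC y
  · ext i
    rw [Function.comp_apply, RingHom.map_mulVec, ← RingHom.mapMatrix_apply, RingHom.map_adjugate,
      hN, hC]

lemma det_dvd_sq_sub_mul {N : Matrix ι ι R} (hN : IsLeftRegular N.det) (hs : N.IsSymm)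
    (x y : ι → R) :
    N.det ∣ (x ⬝ᵥ N.adjugate *ᵥ y) ^ 2 -
      (x ⬝ᵥ N.adjugate *ᵥ x) * (y ⬝ᵥ N.adjugate *ᵥ y) := by
  have h := det_fromBlocks_mul_det_pow N (of ![x, y])ᵀ (of ![x, y]) 0
  rw [Fintype.card_fin, sq, mul_left_comm] at h
  have hminor := hN h
  have hentry (a b : Fin 2) : (of ![x, y] * N.adjugate * (of ![x, y])ᵀ) a b =
      ![x, y] a ⬝ᵥ N.adjugate *ᵥ ![x, y] b := by
    rw [Matrix.mul_assoc]
    rfl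
  have hsym : y ⬝ᵥ N.adjugate *ᵥ x = x ⬝ᵥ N.adjugate *ᵥ y := by
    rw [dotProduct_mulVec, ← mulVec_transpose, adjugate_transpose, hs.eq, dotProduct_comm]
  rw [smul_zero, zero_sub, det_fin_two] at hminor
  simp only [Matrix.neg_apply, hentry, cons_val_zero, cons_val_one, hsym] at hminor
  exact ⟨-(fromBlocks N (of ![x, y])ᵀ (of ![x, y]) 0).det, by linear_combination hminor⟩

/-- The polynomial `χ_A · xᵀ (X - A)⁻¹ y`, where `χ_A` is the characteristic polynomial of `A`; it
encodes all the moments `xᵀ A ^ k y`. -/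
noncomputable def resolventForm (A : Matrix ι ι R) (x y : ι → R) : R[X] :=
  (C ∘ x) ⬝ᵥ (charmatrix A).adjugate *ᵥ (C ∘ y)

variable (A : Matrix ι ι R) (x y : ι → R)

lemma charpoly_add_resolventForm :
    A.charpoly + resolventForm A x y = (A - vecMulVec y x).charpoly := by
  rw [charpoly, resolventForm, ← det_add_vecMulVec, charpoly]
  congr 1
  ext1 i j
  simp only [charmatrix, Matrix.add_apply, Matrix.sub_apply, vecMulVec_apply,
    RingHom.mapMatrix_apply, Matrix.map_apply, Function.comp_apply, C_sub, C_mul]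
  ring

lemma degree_resolventForm_lt : (resolventForm A x y).degree < Fintype.card ι := by
  nontriviality R
  rw [← sub_eq_iff_eq_add'.mpr (charpoly_add_resolventForm A x y).symm,
    ← charpoly_degree_eq_dim (A - vecMulVec y x)]
  refine degree_sub_lt_left ?_ (charpoly_monic _).ne_zero ?_
  · rw [charpoly_degree_eq_dim, charpoly_degree_eq_dim]
  · rw [(charpoly_monic _).leadingCoeff, (charpoly_monic _).leadingCoeff]

lemma X_mul_resolventForm :
    X * resolventForm A x y = resolventForm A x (A *ᵥ y) + A.charpoly * C (x ⬝ᵥ y) := by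
  have hvec : (X : R[X]) • (C ∘ y) = C ∘ (A *ᵥ y) + charmatrix A *ᵥ (C ∘ y) := by
    ext1 i
    simp [charmatrix, Matrix.sub_mulVec, RingHom.map_mulVec, Matrix.scalar_apply]
  have hdot : C (x ⬝ᵥ y) = (C ∘ x) ⬝ᵥ (C ∘ y) := RingHom.map_dotProduct C x y
  rw [resolventForm, ← smul_eq_mul, ← dotProduct_smul, ← mulVec_smul, hvec, mulVec_add,
    dotProduct_add, mulVec_mulVec, adjugate_mul, smul_mulVec, one_mulVec, dotProduct_smul, hdot]
  rfl

lemma coeff_resolventForm (j : ℕ) : (resolventForm A x y).coeff j =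
    (resolventForm A x (A *ᵥ y)).coeff (j + 1) + A.charpoly.coeff (j + 1) * (x ⬝ᵥ y) := by
  have h := congrArg (coeff · (j + 1)) (X_mul_resolventForm A x y)
  simpa only [coeff_X_mul, coeff_add, coeff_mul_C] using h

lemma coeff_resolventForm_card_sub_one :
    (resolventForm A x y).coeff (Fintype.card ι - 1) = x ⬝ᵥ y := by
  nontriviality R
  rcases isEmpty_or_nonempty ι with hι | hι
  · simp [resolventForm, dotProduct]
  have hlead : A.charpoly.coeff (Fintype.card ι) = 1 := by
    rw [← A.charpoly_natDegree_eq_dim]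
    exact A.charpoly_monic
  rw [coeff_resolventForm, Nat.sub_add_cancel Fintype.card_pos, hlead, one_mul,
    coeff_eq_zero_of_degree_lt (degree_resolventForm_lt A x _), zero_add]

variable {A x y}

lemma dotProduct_pow_mulVec_eq_of_resolventForm_eq {A' : Matrix ι ι R} {x' y' : ι → R}
    (hχ : A.charpoly = A'.charpoly) (h : resolventForm A x y = resolventForm A' x' y') (k : ℕ) :
    x ⬝ᵥ (A ^ k) *ᵥ y = x' ⬝ᵥ (A' ^ k) *ᵥ y' := by
  suffices hk : resolventForm A x ((A ^ k) *ᵥ y) = resolventForm A' x' ((A' ^ k) *ᵥ y') by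
    rw [← coeff_resolventForm_card_sub_one A, hk, coeff_resolventForm_card_sub_one]
  induction k with
  | zero => simpa using h
  | succ k ih =>
    have hdot := congrArg (coeff · (Fintype.card ι - 1)) ih
    simp only [coeff_resolventForm_card_sub_one] at hdot
    have hX := congrArg (X * ·) ih
    simp only [X_mul_resolventForm, hχ, hdot, add_left_inj] at hX
    simpa only [pow_succ', ← mulVec_mulVec] using hX

lemma C_dvd_resolventForm {d : R} (h : ∀ k : ℕ, d ∣ x ⬝ᵥ (A ^ k) *ᵥ y) :
    C d ∣ resolventForm A x y := by
  suffices ∀ m j : ℕ, Fintype.card ι ≤ j + m → ∀ y, (∀ k : ℕ, d ∣ x ⬝ᵥ (A ^ k) *ᵥ y) →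
      d ∣ (resolventForm A x y).coeff j from
    C_dvd_iff_dvd_coeff _ _ |>.mpr fun j => this (Fintype.card ι) j (by omega) y h
  intro m
  induction m with
  | zero =>
    intro j hj y _
    have hdeg : (resolventForm A x y).degree < j :=
      (degree_resolventForm_lt A x y).trans_le (by exact_mod_cast hj)
    rw [coeff_eq_zero_of_degree_lt hdeg]
    exact dvd_zero d
  | succ m ih =>
    intro j hj y hy
    rw [coeff_resolventForm]
    have hxy : d ∣ x ⬝ᵥ y := by simpa using hy 0
    refine dvd_add (ih _ (by omega) _ fun k => ?_) (hxy.mul_left _)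
    rw [mulVec_mulVec, ← pow_succ]
    exact hy (k + 1)

theorem dvd_apply_of_sq_dvd_dotProduct_pow_mulVec (hA : A.IsSymm) {a : R}
    (ha : ReflectsSqDvd (AdjoinRoot.of A.charpoly a))
    (hx : ∀ k : ℕ, a ^ 2 ∣ x ⬝ᵥ (A ^ k) *ᵥ x) (i : ι) : a ∣ x i := by
  let e : ι → R := Pi.single i 1
  have hsymm : (charmatrix A).IsSymm := by
    rw [IsSymm, ← charmatrix_transpose, hA.eq]
  obtain ⟨g, hg⟩ := det_dvd_sq_sub_mul A.charpoly_monic.isRegular.left hsymm (C ∘ x) (C ∘ e)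
  obtain ⟨h, hh⟩ := C_dvd_resolventForm hx
  obtain ⟨g', h', hF⟩ := of_dvd_mk_iff.mp <| ha (AdjoinRoot.mk _ (resolventForm A x e)) (by
    rw [← map_pow, ← map_pow]
    refine of_dvd_mk_iff.mpr ⟨g, h * resolventForm A e e, ?_⟩
    rw [← mul_assoc, ← hh]
    exact sub_eq_iff_eq_add.mp hg)
  have hmod : resolventForm A x e = C a * (h' %ₘ A.charpoly) := by
    nontriviality R
    rw [← (modByMonic_eq_self_iff A.charpoly_monic).mpr
      ((degree_resolventForm_lt A x e).trans_eq A.charpoly_degree_eq_dim.symm), hF,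
      add_modByMonic, (modByMonic_eq_zero_iff_dvd A.charpoly_monic).mpr (dvd_mul_right _ _),
      zero_add, ← smul_eq_C_mul, ← smul_eq_C_mul, smul_modByMonic]
  rw [← dotProduct_single_one x i, ← coeff_resolventForm_card_sub_one A, hmod, coeff_C_mul]
  exact dvd_mul_right _ _

lemma charpoly_neg_one_sub_comp (M : Matrix ι ι R) :
    (-1 - M).charpoly.comp (-1 - X) = (-1) ^ Fintype.card ι * M.charpoly := by
  rw [charpoly, ← coe_compRingHom_apply, RingHom.map_det, charpoly, ← det_neg]
  congr 1
  ext1 i j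
  by_cases hij : i = j <;> simp [hij]

lemma resolventForm_one_eq_of_charpoly_compl_eq {A A' : Matrix ι ι R}
    (h1 : A.charpoly = A'.charpoly)
    (h2 : ((of fun _ _ => 1) - 1 - A).charpoly = ((of fun _ _ => 1) - 1 - A').charpoly) :
    resolventForm A 1 1 = resolventForm A' 1 1 := by
  have hcompl (B : Matrix ι ι R) : (of fun _ _ => 1) - 1 - B = -1 - (B - vecMulVec 1 1) := by
    have hJ : vecMulVec 1 1 = (of fun _ _ => 1 : Matrix ι ι R) := by
      ext
      simp
    rw [hJ]
    abel
  have h := congrArg (·.comp (-1 - X)) h2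
  simp only [hcompl, charpoly_neg_one_sub_comp, ← charpoly_add_resolventForm, h1] at h
  exact add_left_cancel ((isUnit_one.neg.pow (Fintype.card ι)).mul_left_cancel h)

end ResolventForm

section Corank

open Matrix

variable {m n ι K : Type*} [Fintype n] [Fintype ι]

lemma exists_eq_vecMulVec_of_rank_le_one [Field K] {E : Matrix m n K} (hE : E.rank ≤ 1) :
    ∃ u v, E = vecMulVec u v := by
  classical
  obtain ⟨u, hu⟩ := finrank_le_one_iff.mp hE
  choose v hv using fun j => hu ⟨E *ᵥ Pi.single j 1, Pi.single j 1, rfl⟩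
  refine ⟨u, v, ?_⟩
  ext i j
  have h := congrFun (congrArg Subtype.val (hv j)) i
  simpa [vecMulVec_apply, mul_comm] using h.symm

lemma exists_smul_eq_of_mulVec_eq_zero [Field K] {W : Matrix m n K}
    (hW : Fintype.card n ≤ W.rank + 1) {x y : n → K} (hx0 : x ≠ 0) (hx : W *ᵥ x = 0)
    (hy : W *ᵥ y = 0) : ∃ c : K, c • x = y := by
  have hker : Module.finrank K (LinearMap.ker W.mulVecLin) ≤ 1 := by
    have h := LinearMap.finrank_range_add_finrank_ker W.mulVecLin
    rw [Module.finrank_fintype_fun_eq_card] at h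
    rw [rank] at hW
    omega
  obtain ⟨w, hw⟩ := finrank_le_one_iff.mp hker
  obtain ⟨a, ha⟩ := hw ⟨x, hx⟩
  obtain ⟨b, hb⟩ := hw ⟨y, hy⟩
  have hax : a • (w : n → K) = x := congrArg Subtype.val ha
  have hby : b • (w : n → K) = y := congrArg Subtype.val hb
  have ha0 : a ≠ 0 := by
    rintro rfl
    exact hx0 (by rw [← hax, zero_smul])
  exact ⟨b * a⁻¹, by rw [← hax, ← hby, smul_smul, inv_mul_cancel_right₀ ha0]⟩

variable [Field K] [LinearOrder K] [IsStrictOrderedRing K]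

lemma eq_zero_of_mul_transpose_self_eq_zero {Z : Matrix m n K} (h : Z * Zᵀ = 0) : Z = 0 := by
  funext i
  exact dotProduct_self_eq_zero.mp (congrFun₂ h i i)

lemma eq_zero_of_isSymm_of_trace_eq_zero_of_mul_eq_zero {E W : Matrix ι ι K} (hE : E.IsSymm)
    (htr : E.trace = 0) (hEW : E * W = 0) (hW : Fintype.card ι ≤ W.rank + 1) : E = 0 := by
  have hrank := rank_add_rank_le_card_of_mul_eq_zero hEW
  obtain ⟨u, v, rfl⟩ := exists_eq_vecMulVec_of_rank_le_one (E := E) (by omega)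
  apply eq_zero_of_mul_transpose_self_eq_zero
  rw [hE.eq, vecMulVec_mul_vecMulVec, dotProduct_comm, ← trace_vecMulVec, htr, zero_smul,
    vecMulVec_zero]

lemma exists_orthogonal_mul_eq_of_gram_eq [DecidableEq ι] {U U' : Matrix ι n K}
    (hgram : Uᵀ * U = U'ᵀ * U') (hU : IsUnit (U * Uᵀ).det) :
    ∃ Q : Matrix ι ι K, Qᵀ * Q = 1 ∧ Q * U = U' := by
  let P := U * Uᵀ
  have hPsymm : Pᵀ = P := by rw [transpose_mul, transpose_transpose]
  have hPU : P⁻¹ * U * (Uᵀ * U) = U := by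
    rw [Matrix.mul_assoc, ← Matrix.mul_assoc U, nonsing_inv_mul_cancel_left _ _ hU]
  refine ⟨U' * Uᵀ * P⁻¹, ?_, sub_eq_zero.mp (eq_zero_of_mul_transpose_self_eq_zero ?_)⟩
  · calc (U' * Uᵀ * P⁻¹)ᵀ * (U' * Uᵀ * P⁻¹) = P⁻¹ * U * (U'ᵀ * U') * Uᵀ * P⁻¹ := by
          simp only [transpose_mul, transpose_nonsing_inv, hPsymm, transpose_transpose,
            Matrix.mul_assoc]
      _ = 1 := by rw [← hgram, hPU, mul_nonsing_inv _ hU]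
  set Z := U' * Uᵀ * P⁻¹ * U - U' with hZ
  have hZU : Z * (Uᵀ * U) = 0 := by
    rw [hZ, Matrix.sub_mul, Matrix.mul_assoc _ P⁻¹, Matrix.mul_assoc _ (P⁻¹ * U), hPU,
      Matrix.mul_assoc, sub_self]
  have hcancel {Y : Matrix ι n K} (hY : Z * (Yᵀ * Y) = 0) : Z * Yᵀ = 0 := by
    apply eq_zero_of_mul_transpose_self_eq_zero
    rw [transpose_mul, transpose_transpose, Matrix.mul_assoc, ← Matrix.mul_assoc Yᵀ,
      ← Matrix.mul_assoc, hY, Matrix.zero_mul]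
  nth_rw 2 [hZ]
  rw [transpose_sub, transpose_mul _ U, Matrix.mul_sub, ← Matrix.mul_assoc, hcancel hZU,
    hcancel (hgram ▸ hZU), Matrix.zero_mul, sub_zero]

variable [DecidableEq ι]

lemma eq_zero_of_transpose_mulVec_eq_zero_of_adjugate_mulVec_eq_zero {W : Matrix ι ι K}
    (hW : Fintype.card ι ≤ W.rank + 1) {z : ι → K} (hz : Wᵀ *ᵥ z = 0)
    (hadj : W.adjugate *ᵥ z = 0) : z = 0 := by
  by_contra hz0
  have hdet : W.det = 0 := by
    rw [← det_transpose]
    exact exists_mulVec_eq_zero_iff.mp ⟨z, hz0, hz⟩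
  obtain ⟨x, hx0, hx⟩ := exists_mulVec_eq_zero_iff.mpr hdet
  have hdet' : (W + vecMulVec z x).det = 0 := by
    rw [det_add_vecMulVec, hdet, hadj, dotProduct_zero, add_zero]
  obtain ⟨y, hy0, hy⟩ := exists_mulVec_eq_zero_iff.mpr hdet'
  rw [add_mulVec, vecMulVec_mulVec, op_smul_eq_smul] at hy
  have hxy : x ⬝ᵥ y = 0 := by
    have h := congrArg (z ⬝ᵥ ·) hy
    simp only [dotProduct_add, dotProduct_zero, dotProduct_smul, smul_eq_mul] at h
    rw [dotProduct_mulVec, ← mulVec_transpose, hz, zero_dotProduct, zero_add] at h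
    exact (mul_eq_zero.mp h).resolve_right (hz0 <| dotProduct_self_eq_zero.mp ·)
  rw [hxy, zero_smul, add_zero] at hy
  obtain ⟨c, rfl⟩ := exists_smul_eq_of_mulVec_eq_zero hW hx0 hx hy
  rw [dotProduct_smul, smul_eq_mul] at hxy
  have hc : c = 0 := (mul_eq_zero.mp hxy).resolve_right (hx0 <| dotProduct_self_eq_zero.mp ·)
  exact hy0 (by rw [hc, zero_smul])

lemma isUnit_det_mul_transpose_of_transpose_mulVec_eq_zero {U : Matrix ι n K}
    (hU : ∀ z, Uᵀ *ᵥ z = 0 → z = 0) : IsUnit (U * Uᵀ).det := by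
  rw [isUnit_iff_ne_zero]
  intro hdet
  obtain ⟨z, hz0, hz⟩ := exists_mulVec_eq_zero_iff.mpr hdet
  refine hz0 (hU z (dotProduct_self_eq_zero.mp ?_))
  rw [dotProduct_mulVec, vecMul_transpose, mulVec_mulVec, hz, zero_dotProduct]

/- The rows of the adjugate complete the columns of a singular `W` to a spanning family; their Gram
matrix `adj W * (adj W)ᵀ` depends on `Wᵀ * W` only. -/
theorem exists_orthogonal_mul_eq_of_gram_eq_of_card_le_rank_add_one {W W' : Matrix ι ι K}
    (hgram : Wᵀ * W = W'ᵀ * W') (hW : Fintype.card ι ≤ W.rank + 1) :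
    ∃ Q : Matrix ι ι K, Qᵀ * Q = 1 ∧ Q * W = W' := by
  have hadj : W.adjugate * W.adjugateᵀ = W'.adjugate * W'.adjugateᵀ := by
    simp only [adjugate_transpose, ← adjugate_mul_distrib, hgram]
  obtain ⟨ε, hε, hdet⟩ : ∃ ε : K, ε * ε = 1 ∧ W.det = ε * W'.det := by
    have h := congrArg det hgram
    simp only [det_mul, det_transpose] at h
    rcases mul_self_eq_mul_self_iff.mp h with h | h
    · exact ⟨1, one_mul 1, by rw [h, one_mul]⟩
    · exact ⟨-1, by ring, by rw [h, neg_one_mul]⟩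
  have hcols (Y : Matrix ι ι K) (c : K) :
      (fromCols Y (c • Y.adjugateᵀ))ᵀ * fromCols Y (c • Y.adjugateᵀ) =
        fromBlocks (Yᵀ * Y) ((c * Y.det) • 1) ((c * Y.det) • 1)
          ((c * c) • (Y.adjugate * Y.adjugateᵀ)) := by
    rw [transpose_fromCols, fromRows_mul_fromCols, transpose_smul, transpose_transpose]
    congr 1
    · rw [Matrix.mul_smul, ← transpose_mul, adjugate_mul, transpose_smul, transpose_one, smul_smul]
    · rw [Matrix.smul_mul, adjugate_mul, smul_smul]
    · rw [Matrix.smul_mul, Matrix.mul_smul, smul_smul]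
  obtain ⟨Q, hQ, hQU⟩ := exists_orthogonal_mul_eq_of_gram_eq
    (U := fromCols W ((1 : K) • W.adjugateᵀ)) (U' := fromCols W' (ε • W'.adjugateᵀ))
    (by rw [hcols, hcols, hgram, hadj, hε, hdet, one_mul, one_mul])
    (isUnit_det_mul_transpose_of_transpose_mulVec_eq_zero fun z hz => by
      rw [one_smul, transpose_fromCols, transpose_transpose, fromRows_mulVec] at hz
      exact eq_zero_of_transpose_mulVec_eq_zero_of_adjugate_mulVec_eq_zero hW
        (funext fun i => congrFun hz (.inl i)) (funext fun i => congrFun hz (.inr i)))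
  rw [mul_fromCols] at hQU
  exact ⟨Q, hQ, (fromCols_inj hQU).1⟩

end Corank

section Krylov

open Matrix

variable {ι R K : Type*} [Fintype ι] [DecidableEq ι]

/-- The square matrix whose columns are `x, A x, …, A ^ (n - 1) x`. The columns are indexed by `ι`,
through an arbitrary enumeration, so that the matrix has an adjugate. -/
noncomputable def krylovMatrix [CommRing R] (A : Matrix ι ι R) (x : ι → R) : Matrix ι ι R :=
  of fun i j => (A ^ (Fintype.equivFin ι j : ℕ) *ᵥ x) i

lemma mulVec_pow_mulVec_eq [CommRing R] {A A' Q : Matrix ι ι R} {x x' : ι → R}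
    (hχ : A.charpoly = A'.charpoly) (hQ : Q * krylovMatrix A x = krylovMatrix A' x') (k : ℕ) :
    Q *ᵥ (A ^ k *ᵥ x) = A' ^ k *ᵥ x' := by
  nontriviality R
  have hlt (i : ℕ) (hi : i < Fintype.card ι) : Q *ᵥ (A ^ i *ᵥ x) = A' ^ i *ᵥ x' := by
    have h := congrArg (·.col ((Fintype.equivFin ι).symm ⟨i, hi⟩)) hQ
    ext l
    simpa [krylovMatrix, mul_apply, mulVec, dotProduct] using congrFun h l
  rw [pow_eq_aeval_mod_charpoly A k, pow_eq_aeval_mod_charpoly A' k, hχ]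
  have hdeg : (X ^ k %ₘ A'.charpoly).degree < Fintype.card ι :=
    A'.charpoly_degree_eq_dim ▸ degree_modByMonic_lt (X ^ k) A'.charpoly_monic
  simp only [aeval_eq_sum_range, sum_mulVec, mulVec_sum, smul_mulVec, mulVec_smul]
  refine Finset.sum_congr rfl fun i _ => ?_
  by_cases hi : i < Fintype.card ι
  · rw [hlt i hi]
  · rw [coeff_eq_zero_of_degree_lt (hdeg.trans_le (by exact_mod_cast not_lt.mp hi)), zero_smul,
      zero_smul]

lemma transpose_krylovMatrix_mul_self_apply [CommRing R] {A : Matrix ι ι R} (hA : A.IsSymm)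
    (x : ι → R) (i j : ι) : ((krylovMatrix A x)ᵀ * krylovMatrix A x) i j =
      x ⬝ᵥ A ^ (Fintype.equivFin ι i + Fintype.equivFin ι j : ℕ) *ᵥ x := by
  rw [pow_add, ← mulVec_mulVec, dotProduct_mulVec, ← mulVec_transpose, transpose_pow, hA.eq]
  rfl

theorem exists_orthogonal_mul_eq_mul [Field K] [LinearOrder K] [IsStrictOrderedRing K]
    {A A' : Matrix ι ι K} {x x' : ι → K} (hA : A.IsSymm) (hA' : A'.IsSymm)
    (hχ : A.charpoly = A'.charpoly) (hx : ∀ k : ℕ, x ⬝ᵥ A ^ k *ᵥ x = x' ⬝ᵥ A' ^ k *ᵥ x')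
    (hW : Fintype.card ι ≤ (krylovMatrix A x).rank + 1) :
    ∃ Q : Matrix ι ι K, Qᵀ * Q = 1 ∧ Q * A = A' * Q ∧ Q *ᵥ x = x' := by
  have hgram : (krylovMatrix A x)ᵀ * krylovMatrix A x =
      (krylovMatrix A' x')ᵀ * krylovMatrix A' x' := by
    ext i j
    rw [transpose_krylovMatrix_mul_self_apply hA, transpose_krylovMatrix_mul_self_apply hA', hx]
  have hW' : Fintype.card ι ≤ (krylovMatrix A' x').rank + 1 := by
    rwa [← rank_transpose_mul_self, ← hgram, rank_transpose_mul_self]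
  obtain ⟨Q, hQ, hQW⟩ := exists_orthogonal_mul_eq_of_gram_eq_of_card_le_rank_add_one hgram hW
  have hpow := mulVec_pow_mulVec_eq hχ hQW
  refine ⟨Q, hQ, ?_, by simpa using hpow 0⟩
  have hAW : Q * (A * krylovMatrix A x) = A' * krylovMatrix A' x' := by
    ext i j
    have h := hpow (Fintype.equivFin ι j + 1)
    rw [pow_succ', pow_succ', ← mulVec_mulVec, ← mulVec_mulVec] at h
    exact congrFun h i
  have hzero : (Q * A * Qᵀ - A') = 0 := by
    refine eq_zero_of_isSymm_of_trace_eq_zero_of_mul_eq_zero ?_ ?_ ?_ hW'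
    · rw [IsSymm, transpose_sub, transpose_mul, transpose_mul, transpose_transpose, hA.eq, hA'.eq,
        Matrix.mul_assoc]
    · rw [trace_sub, trace_mul_cycle, hQ, Matrix.one_mul, trace_eq_neg_charpoly_nextCoeff, hχ,
        ← trace_eq_neg_charpoly_nextCoeff, sub_self]
    · rw [Matrix.sub_mul, ← hAW, ← hQW, Matrix.mul_assoc, ← Matrix.mul_assoc Qᵀ, hQ,
        Matrix.one_mul, Matrix.mul_assoc, sub_self]
  rw [← sub_eq_zero.mp hzero, Matrix.mul_assoc, hQ, Matrix.mul_one]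

end Krylov

section Integral

open Matrix

variable {ι R K : Type*} [Fintype ι] [DecidableEq ι] [CommRing R]

lemma map_krylovMatrix [CommRing K] (f : R →+* K) (A : Matrix ι ι R) (x : ι → R) :
    (krylovMatrix A x).map f = krylovMatrix (A.map f) (f ∘ x) := by
  ext i j
  simp only [krylovMatrix, map_apply, of_apply, ← RingHom.mapMatrix_apply, ← map_pow,
    RingHom.map_mulVec]

lemma map_dotProduct_pow_mulVec [CommRing K] (f : R →+* K) (A : Matrix ι ι R) (x : ι → R) (k : ℕ) :
    (f ∘ x) ⬝ᵥ A.map f ^ k *ᵥ (f ∘ x) = f (x ⬝ᵥ A ^ k *ᵥ x) := by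
  rw [RingHom.map_dotProduct, ← RingHom.mapMatrix_apply, ← map_pow]
  congr 1
  ext i
  simp only [Function.comp_apply, RingHom.map_mulVec, RingHom.mapMatrix_apply]

variable [IsDomain R] [Field K] [Algebra R K] [IsFractionRing R K]

theorem exists_algebraMap_eq_of_dotProduct_pow_mulVec {A : Matrix ι ι R} (hA : A.IsSymm)
    (hχ : ∀ a : R, a ≠ 0 → ReflectsSqDvd (AdjoinRoot.of A.charpoly a)) {x : ι → K}
    (hx : ∀ k : ℕ, ∃ z : R, x ⬝ᵥ A.map (algebraMap R K) ^ k *ᵥ x = algebraMap R K z) (i : ι) :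
    ∃ z : R, algebraMap R K z = x i := by
  obtain ⟨⟨a, ha⟩, hax⟩ := IsLocalization.exist_integer_multiples_of_finite (nonZeroDivisors R) x
  choose y hy using hax
  have ha0 := nonZeroDivisors.ne_zero ha
  have hinj := IsFractionRing.injective R K
  have hyx : algebraMap R K ∘ y = algebraMap R K a • x := by
    ext j
    rw [Function.comp_apply, hy, Algebra.smul_def, Pi.smul_apply, smul_eq_mul]
  obtain ⟨z, hz⟩ := dvd_apply_of_sq_dvd_dotProduct_pow_mulVec (x := y) hA (hχ a ha0) (fun k => by
    obtain ⟨z, hz⟩ := hx k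
    refine ⟨z, hinj ?_⟩
    rw [← map_dotProduct_pow_mulVec, hyx, mulVec_smul, dotProduct_smul, smul_dotProduct, hz,
      map_mul, map_pow, smul_eq_mul, smul_eq_mul]
    ring) i
  refine ⟨z, mul_left_cancel₀ ((map_ne_zero_iff _ hinj).mpr ha0) ?_⟩
  rw [← map_mul, ← hz]
  exact congrFun hyx i

lemma exists_map_eq_of_mul_transpose_eq_one {A A' : Matrix ι ι R} (hA : A.IsSymm)
    (hχ : ∀ a : R, a ≠ 0 → ReflectsSqDvd (AdjoinRoot.of A.charpoly a)) {Q : Matrix ι ι K}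
    (hQ : Q * Qᵀ = 1) (hQA : Q * A.map (algebraMap R K) = A'.map (algebraMap R K) * Q) :
    ∃ Z : Matrix ι ι R, Z.map (algebraMap R K) = Q := by
  have hpow (k : ℕ) : Q * A.map (algebraMap R K) ^ k * Qᵀ = (A' ^ k).map (algebraMap R K) := by
    have h : SemiconjBy Q (A.map (algebraMap R K)) (A'.map (algebraMap R K)) := hQA
    rw [(h.pow_right k).eq, Matrix.mul_assoc, hQ, Matrix.mul_one]
    exact (map_pow (algebraMap R K).mapMatrix A' k).symm
  have hint (i : ι) := exists_algebraMap_eq_of_dotProduct_pow_mulVec (x := Q i) hA hχ fun k =>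
    ⟨(A' ^ k) i i, by
      have h := congrFun₂ (hpow k) i i
      rwa [Matrix.mul_assoc] at h⟩
  choose Z hZ using hint
  exact ⟨of Z, ext hZ⟩

end Integral

section Permutation

open Matrix

variable {ι : Type*} [Fintype ι] [DecidableEq ι]

lemma exists_eq_single_of_sum_eq_one_of_sum_mul_self_eq_one {z : ι → ℤ} (hsum : ∑ j, z j = 1)
    (hsq : ∑ j, z j * z j = 1) : ∃ j, z = Pi.single j 1 := by
  have hnonneg (a : ℤ) : 0 ≤ a * a - a := by
    rcases le_or_gt a 0 with h | h <;> nlinarith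
  have hzero : ∑ j, (z j * z j - z j) = 0 := by
    rw [Finset.sum_sub_distrib, hsq, hsum, sub_self]
  have h01 (j : ι) : z j = 0 ∨ z j = 1 := by
    have h := (Fintype.sum_eq_zero_iff_of_nonneg fun j => hnonneg (z j)).mp hzero
    have hj : z j * (z j - 1) = 0 := (mul_sub_one _ _).trans (congrFun h j)
    exact (mul_eq_zero.mp hj).imp_right sub_eq_zero.mp
  obtain ⟨j, -, hj⟩ := Finset.exists_ne_zero_of_sum_ne_zero (hsum.trans_ne one_ne_zero)
  refine ⟨j, funext fun k => ?_⟩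
  obtain rfl | hk := eq_or_ne k j
  · rw [Pi.single_eq_same, (h01 k).resolve_left hj]
  · rw [Pi.single_eq_of_ne hk]
    rw [← Finset.add_sum_erase _ _ (Finset.mem_univ j), (h01 j).resolve_left hj,
      add_eq_left] at hsum
    refine (Finset.sum_eq_zero_iff_of_nonneg fun l _ => ?_).mp hsum k (by simp [hk])
    rcases h01 l with hl | hl <;> simp [hl]

lemma exists_permMatrix_eq_of_mul_transpose_eq_one {Z : Matrix ι ι ℤ} (hZ : Z * Zᵀ = 1)
    (hone : Z *ᵥ 1 = 1) : ∃ σ : Equiv.Perm ι, σ.permMatrix ℤ = Z := by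
  have hrow (i : ι) : ∃ j, Z i = Pi.single j 1 :=
    exists_eq_single_of_sum_eq_one_of_sum_mul_self_eq_one
      (by simpa [mulVec, dotProduct] using congrFun hone i)
      (by simpa [mul_apply] using congrFun₂ hZ i i)
  choose σ hσ using hrow
  have hinj : Function.Injective σ := by
    intro i i' h
    by_contra hne
    have hii' := congrFun₂ hZ i i'
    rw [one_apply_ne hne, mul_apply] at hii'
    simp [hσ, h, Pi.single_apply] at hii'
  refine ⟨Equiv.ofBijective σ (Finite.injective_iff_bijective.mp hinj), ?_⟩
  ext i j
  simp [Equiv.Perm.permMatrix, PEquiv.toMatrix_apply, hσ, Pi.single_apply, eq_comm]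

theorem exists_perm_of_charpoly_compl_eq {A A' : Matrix ι ι ℤ} (hA : A.IsSymm) (hA' : A'.IsSymm)
    (h1 : A.charpoly = A'.charpoly)
    (h2 : ((of fun _ _ => 1) - 1 - A).charpoly = ((of fun _ _ => 1) - 1 - A').charpoly)
    (hχ : ∀ a : ℤ, a ≠ 0 → ReflectsSqDvd (AdjoinRoot.of A.charpoly a))
    (hW : Fintype.card ι ≤ ((krylovMatrix A 1).map (Int.cast : ℤ → ℚ)).rank + 1) :
    ∃ σ : Equiv.Perm ι, A.submatrix σ σ = A' := by
  let φ := algebraMap ℤ ℚ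
  have hmoment := dotProduct_pow_mulVec_eq_of_resolventForm_eq h1
    (resolventForm_one_eq_of_charpoly_compl_eq h1 h2)
  obtain ⟨Q, hQ, hQA, hQ1⟩ := exists_orthogonal_mul_eq_mul (x := φ ∘ 1) (x' := φ ∘ 1)
    (hA.map φ) (hA'.map φ) (by rw [charpoly_map, charpoly_map, h1])
    (fun k => by rw [map_dotProduct_pow_mulVec, map_dotProduct_pow_mulVec, hmoment])
    (by rw [← map_krylovMatrix]; exact hW)
  have hQ' : Q * Qᵀ = 1 := mul_eq_one_comm.mp hQ
  obtain ⟨Z, rfl⟩ := exists_map_eq_of_mul_transpose_eq_one hA hχ hQ' hQA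
  have hinj : Function.Injective (φ.mapMatrix (m := ι)) := map_injective Int.cast_injective
  have hZ : Z * Zᵀ = 1 := hinj <| by rw [map_mul, map_one]; exact hQ'
  have hZ1 : Z *ᵥ 1 = 1 := by
    ext i
    refine Int.cast_injective (α := ℚ) ?_
    exact (RingHom.map_mulVec φ Z 1 i).trans (congrFun hQ1 i)
  have hZA : Z * A = A' * Z := hinj <| by rw [map_mul, map_mul]; exact hQA
  obtain ⟨σ, rfl⟩ := exists_permMatrix_eq_of_mul_transpose_eq_one hZ hZ1
  refine ⟨σ, ext fun i j => ?_⟩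
  have h := congrFun₂ hZA i (σ j)
  simpa [Equiv.Perm.permMatrix, PEquiv.toMatrix_toPEquiv_mul, PEquiv.mul_toMatrix_toPEquiv] using h

end Permutation

section Bipartite

open Matrix

lemma X_pow_card_mul_charpoly_fromBlocks {m n R : Type*} [Fintype m] [DecidableEq m] [Fintype n]
    [DecidableEq n] [CommRing R] (B : Matrix m n R) :
    X ^ Fintype.card m * (fromBlocks 0 B Bᵀ 0).charpoly =
      X ^ Fintype.card n * expand R 2 (B * Bᵀ).charpoly := by
  have hmul : (fromBlocks 0 B Bᵀ 0).charmatrix * fromBlocks ((X : R[X]) • 1) 0 (Bᵀ.map C) 1 =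
      fromBlocks ((B * Bᵀ).charmatrix.map (expand R 2)) (-B.map C) 0 ((X : R[X]) • 1) := by
    rw [charmatrix_fromBlocks, charmatrix_zero, charmatrix_zero, scalar_apply, scalar_apply,
      ← smul_one_eq_diagonal, ← smul_one_eq_diagonal, fromBlocks_multiply]
    congr 1
    · ext1 i j
      by_cases hij : i = j
      · subst hij
        simp [mul_apply, sq, sub_eq_add_neg]
      · simp [mul_apply, hij]
    all_goals simp
  have hdet := congrArg det hmul
  have hexpand : ((B * Bᵀ).charmatrix.map (expand R 2)).det = expand R 2 (B * Bᵀ).charpoly :=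
    (AlgHom.map_det (expand R 2) _).symm
  rw [det_mul, det_fromBlocks_zero₁₂, det_fromBlocks_zero₂₁, hexpand, det_one, mul_one, det_smul,
    det_smul, det_one, det_one, mul_one, mul_one] at hdet
  rw [mul_comm, charpoly, hdet, mul_comm]

lemma isSymm_mul_transpose_self {m n R : Type*} [Fintype n] [CommRing R] (B : Matrix m n R) :
    (B * Bᵀ).IsSymm := by
  rw [IsSymm, transpose_mul, transpose_transpose]

end Bipartite

lemma abs_discr_expand_two {p : ℤ[X]} (hp : p.Monic) (h0 : IsUnit (p.coeff 0)) :
    |(expand ℤ 2 p).discr| = 4 ^ p.natDegree * p.discr ^ 2 := by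
  rw [discr_expand_two hp, abs_mul, abs_mul, abs_pow, abs_neg, Int.isUnit_iff_abs_eq.mp h0,
    mul_one, abs_sq, abs_of_pos four_pos]

lemma abs_discr_X_mul {p : ℤ[X]} (hp : p.Monic) (h0 : IsUnit (p.coeff 0)) :
    |(X * p).discr| = |p.discr| := by
  rw [discr_X_mul hp, Int.isUnit_sq h0, one_mul]

namespace SignedGraph

section Adjacency

variable {V : Type u} {W : Type v} (S : SignedGraph V) {T : SignedGraph W}

lemma adjMatrix_of_adj {i j : V} (h : S.graph.Adj i j) :
    S.adjMatrix i j = (S.sign ⟨s(i, j), S.graph.mem_edgeSet.mpr h⟩ : ℤ) := by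
  simp [adjMatrix, h]

lemma adjMatrix_of_not_adj {i j : V} (h : ¬ S.graph.Adj i j) : S.adjMatrix i j = 0 := by
  simp [adjMatrix, h]

lemma adjMatrix_ne_zero_iff {i j : V} : S.adjMatrix i j ≠ 0 ↔ S.graph.Adj i j := by
  by_cases h : S.graph.Adj i j
  · simp [S.adjMatrix_of_adj h, h]
  · simp [S.adjMatrix_of_not_adj h, h]

lemma adjMatrix_isSymm : S.adjMatrix.IsSymm := by
  ext i j
  rw [Matrix.transpose_apply]
  by_cases h : S.graph.Adj i j
  · rw [S.adjMatrix_of_adj h, S.adjMatrix_of_adj h.symm]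
    congr 2
    exact Subtype.ext Sym2.eq_swap
  · rw [S.adjMatrix_of_not_adj h, S.adjMatrix_of_not_adj fun h' => h h'.symm]

variable {S}

lemma isIsomorphic_of_adjMatrix_eq (f : V ≃ W) (hf : T.adjMatrix.submatrix f f = S.adjMatrix) :
    S.IsIsomorphic T := by
  have hadj (i j : V) : T.graph.Adj (f i) (f j) ↔ S.graph.Adj i j := by
    rw [← adjMatrix_ne_zero_iff, ← adjMatrix_ne_zero_iff, ← hf, Matrix.submatrix_apply]
  refine ⟨⟨f, fun {i j} => hadj i j⟩, ?_⟩
  rintro ⟨e, he⟩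
  induction e using Sym2.ind with
  | _ i j =>
    have hij := congrFun₂ hf i j
    rw [Matrix.submatrix_apply, S.adjMatrix_of_adj he,
      T.adjMatrix_of_adj ((hadj i j).mpr he)] at hij
    exact Units.ext hij

end Adjacency

lemma exists_isBipartiteWith_card_le {V : Type u} [Fintype V] {S : SignedGraph V}
    (h : S.graph.IsBipartite) :
    ∃ X : Finset V, S.graph.IsBipartiteWith (X : Set V) (X : Set V)ᶜ ∧
      X.card ≤ Fintype.card V / 2 := by
  classical
  obtain ⟨s, t, hst⟩ := SimpleGraph.isBipartite_iff_exists_isBipartiteWith.mp h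
  have hs : S.graph.IsBipartiteWith s sᶜ :=
    ⟨disjoint_compl_right, fun v w hvw => (hst.mem_of_adj hvw).imp
      (fun h => ⟨h.1, fun h' => Set.disjoint_left.mp hst.disjoint h' h.2⟩)
      (fun h => ⟨fun h' => Set.disjoint_left.mp hst.disjoint h' h.1, h.2⟩)⟩
  by_cases hc : s.toFinset.card ≤ Fintype.card V / 2
  · exact ⟨s.toFinset, by simpa using hs, hc⟩
  · refine ⟨s.toFinsetᶜ, by simpa using hs.symm, ?_⟩
    rw [Finset.card_compl]
    omega

section Bipartite

open Matrix

variable {V : Type u} [DecidableEq V] {S : SignedGraph V} {X : Finset V}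

lemma reindex_adjMatrix_eq_fromBlocks
    (hX : S.graph.IsBipartiteWith (X : Set V) (X : Set V)ᶜ) :
    reindex (Equiv.sumCompl (· ∈ X)).symm (Equiv.sumCompl (· ∈ X)).symm S.adjMatrix =
      fromBlocks 0 (S.block X) (S.block X)ᵀ 0 := by
  ext (i | i) (j | j)
  · refine S.adjMatrix_of_not_adj fun hadj => ?_
    rcases hX.mem_of_adj hadj with h | h
    · exact h.2 j.2
    · exact h.1 i.2
  · rfl
  · exact S.adjMatrix_isSymm.apply _ _
  · refine S.adjMatrix_of_not_adj fun hadj => ?_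
    rcases hX.mem_of_adj hadj with h | h
    · exact i.2 h.1
    · exact j.2 h.2

variable [Fintype V]

lemma charpoly_eq_X_pow_mul_expand (hX : S.graph.IsBipartiteWith (X : Set V) (X : Set V)ᶜ)
    (hcard : X.card ≤ Fintype.card V / 2) :
    S.charpoly = Polynomial.X ^ (Fintype.card V - 2 * X.card) *
      expand ℤ 2 (S.block X * (S.block X)ᵀ).charpoly := by
  have h := X_pow_card_mul_charpoly_fromBlocks (S.block X)
  rw [← reindex_adjMatrix_eq_fromBlocks hX, charpoly_reindex, Fintype.card_coe,
    Fintype.card_subtype_compl, Fintype.card_coe, show Fintype.card V - X.card =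
      X.card + (Fintype.card V - 2 * X.card) by omega, pow_add, mul_assoc] at h
  exact mul_left_cancel₀ (pow_ne_zero _ X_ne_zero) h

lemma isUnit_charpoly_coeff_mod_two
    (heven : Even (Fintype.card V) → S.charpoly.coeff 0 = 1 ∨ S.charpoly.coeff 0 = -1)
    (hodd : Odd (Fintype.card V) → S.charpoly.coeff 1 = 1 ∨ S.charpoly.coeff 1 = -1) :
    IsUnit (S.charpoly.coeff (Fintype.card V % 2)) := by
  rw [Int.isUnit_iff]
  rcases Nat.even_or_odd (Fintype.card V) with h | h
  · rw [Nat.even_iff.mp h]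
    exact heven h
  · rw [Nat.odd_iff.mp h]
    exact hodd h

lemma card_eq_half_of_isUnit_coeff (hX : S.graph.IsBipartiteWith (X : Set V) (X : Set V)ᶜ)
    (hcard : X.card ≤ Fintype.card V / 2)
    (h : IsUnit (S.charpoly.coeff (Fintype.card V % 2))) : X.card = Fintype.card V / 2 := by
  by_contra hne
  rw [charpoly_eq_X_pow_mul_expand hX hcard, coeff_X_pow_mul', if_neg (by omega)] at h
  exact not_isUnit_zero h

lemma charpoly_eq_X_pow_mod_two_mul_expand
    (hX : S.graph.IsBipartiteWith (X : Set V) (X : Set V)ᶜ)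
    (hcard : X.card ≤ Fintype.card V / 2)
    (h : IsUnit (S.charpoly.coeff (Fintype.card V % 2))) :
    S.charpoly = Polynomial.X ^ (Fintype.card V % 2) *
      expand ℤ 2 (S.block X * (S.block X)ᵀ).charpoly := by
  rw [charpoly_eq_X_pow_mul_expand hX hcard, card_eq_half_of_isUnit_coeff hX hcard h,
    ← Nat.mod_eq_sub]

lemma isUnit_coeff_zero_charpoly_block (hX : S.graph.IsBipartiteWith (X : Set V) (X : Set V)ᶜ)
    (hcard : X.card ≤ Fintype.card V / 2)
    (h : IsUnit (S.charpoly.coeff (Fintype.card V % 2))) :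
    IsUnit ((S.block X * (S.block X)ᵀ).charpoly.coeff 0) := by
  have hcoeff := coeff_X_pow_mul (expand ℤ 2 (S.block X * (S.block X)ᵀ).charpoly)
    (Fintype.card V % 2) 0
  rw [← charpoly_eq_X_pow_mod_two_mul_expand hX hcard h, zero_add, coeff_expand two_pos,
    if_pos (dvd_zero 2), Nat.zero_div] at hcoeff
  rwa [← hcoeff]

theorem discr_eq_of_isBipartiteWith (hX : S.graph.IsBipartiteWith (X : Set V) (X : Set V)ᶜ)
    (hcard : X.card ≤ Fintype.card V / 2)
    (h : IsUnit (S.charpoly.coeff (Fintype.card V % 2))) :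
    S.discr = (2 ^ (Fintype.card V / 2) * (S.block X * (S.block X)ᵀ).charpoly.discr) ^ 2 := by
  have hnonneg : 0 ≤ S.discr := discr_charpoly_nonneg S.adjMatrix_isSymm
  have h0 := isUnit_coeff_zero_charpoly_block hX hcard h
  have hp := (S.block X * (S.block X)ᵀ).charpoly_monic
  have h0' : IsUnit ((expand ℤ 2 (S.block X * (S.block X)ᵀ).charpoly).coeff 0) := by
    simpa [coeff_expand two_pos] using h0
  have habs : |S.discr| = |(expand ℤ 2 (S.block X * (S.block X)ᵀ).charpoly).discr| := by
    rw [discr, charpoly_eq_X_pow_mod_two_mul_expand hX hcard h]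
    rcases Nat.mod_two_eq_zero_or_one (Fintype.card V) with hr | hr <;> rw [hr]
    · rw [pow_zero, one_mul]
    · rw [pow_one, abs_discr_X_mul (hp.expand two_pos) h0']
  rw [← abs_of_nonneg hnonneg, habs, abs_discr_expand_two hp h0, charpoly_natDegree_eq_dim,
    Fintype.card_coe, card_eq_half_of_isUnit_coeff hX hcard h, mul_pow, ← pow_mul, mul_comm _ 2,
    pow_mul]
  norm_num

theorem sqrt_discr_div_eq (hX : S.graph.IsBipartiteWith (X : Set V) (X : Set V)ᶜ)
    (hcard : X.card ≤ Fintype.card V / 2)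
    (h : IsUnit (S.charpoly.coeff (Fintype.card V % 2))) :
    √(S.discr : ℝ) / 2 ^ (Fintype.card V / 2) =
      ((S.block X * (S.block X)ᵀ).charpoly.discr : ℝ) := by
  have hnonneg : (0 : ℝ) ≤ (S.block X * (S.block X)ᵀ).charpoly.discr :=
    Int.cast_nonneg (discr_charpoly_nonneg (isSymm_mul_transpose_self _))
  rw [discr_eq_of_isBipartiteWith hX hcard h, Int.cast_pow, Int.cast_mul, Int.cast_pow,
    Int.cast_ofNat, Real.sqrt_sq (by positivity), mul_div_cancel_left₀ _ (by positivity)]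

theorem reflectsSqDvd_of_isBipartiteWith (hX : S.graph.IsBipartiteWith (X : Set V) (X : Set V)ᶜ)
    (hcard : X.card ≤ Fintype.card V / 2)
    (h : IsUnit (S.charpoly.coeff (Fintype.card V % 2))) {q : ℕ} (hq : q.Prime)
    (hd : ¬ (q : ℤ) ^ 2 ∣ (S.block X * (S.block X)ᵀ).charpoly.discr) :
    ReflectsSqDvd (AdjoinRoot.of S.charpoly q) := by
  have h0 := isUnit_coeff_zero_charpoly_block hX hcard h
  have hE := reflectsSqDvd_of_expand_two (charpoly_monic _) h0 hq hd
  rw [charpoly_eq_X_pow_mod_two_mul_expand hX hcard h]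
  rcases Nat.mod_two_eq_zero_or_one (Fintype.card V) with hr | hr <;> rw [hr]
  · rwa [pow_zero, one_mul]
  · rw [pow_one]
    exact hE.of_X_mul (Nat.prime_iff_prime_int.mp hq) (by simpa [coeff_expand two_pos] using h0)

end Bipartite

section Spectrum

open Matrix

variable {V : Type u} [Fintype V] [DecidableEq V] {S : SignedGraph V}

lemma walkRank_eq_rank_krylovMatrix :
    S.walkRank = ((krylovMatrix S.adjMatrix 1).map (Int.cast : ℤ → ℚ)).rank :=
  (rank_submatrix (S.walkMatrix.map Int.cast) (Equiv.refl V) (Fintype.equivFin V)).symm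

lemma card_le_rank_krylovMatrix_add_one (h : S.IsControllable ∨ S.IsAlmostControllable) :
    Fintype.card V ≤ ((krylovMatrix S.adjMatrix 1).map (Int.cast : ℤ → ℚ)).rank + 1 := by
  rw [IsControllable, IsAlmostControllable, walkRank_eq_rank_krylovMatrix] at h
  omega

theorem isDGS_of_reflectsSqDvd (hctrl : S.IsControllable ∨ S.IsAlmostControllable)
    (hχ : ∀ a : ℤ, a ≠ 0 → ReflectsSqDvd (AdjoinRoot.of S.charpoly a)) :
    SignedGraph.IsDGS.{u, v} S := by
  rintro W _ _ T ⟨h1, h2⟩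
  have hcard : Fintype.card V = Fintype.card W := by
    rw [← charpoly_natDegree_eq_dim S.adjMatrix, ← charpoly_natDegree_eq_dim T.adjMatrix]
    exact congrArg natDegree h1
  let e : V ≃ W := Fintype.equivOfCardEq hcard
  have hcompl : T.complCharpoly =
      ((of fun _ _ => 1) - 1 - T.adjMatrix.submatrix e e).charpoly := by
    rw [complCharpoly, ← charpoly_reindex e.symm]
    congr 1
    ext i j
    simp [one_apply]
  obtain ⟨σ, hσ⟩ := exists_perm_of_charpoly_compl_eq S.adjMatrix_isSymm
    (T.adjMatrix_isSymm.submatrix e) (h1.trans (charpoly_reindex e.symm T.adjMatrix).symm)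
    (h2.trans hcompl) hχ
    (card_le_rank_krylovMatrix_add_one hctrl)
  refine isIsomorphic_of_adjMatrix_eq (σ.symm.trans e) ?_
  rw [Equiv.coe_trans, ← submatrix_submatrix, ← hσ, submatrix_submatrix, Equiv.self_comp_symm,
    submatrix_id_id]

end Spectrum

end SignedGraph

theorem theorem2 {V : Type u} [Fintype V] [DecidableEq V] (S : SignedGraph V)
    (hbip : S.graph.IsBipartite)
    (hctrl : S.IsControllable ∨ S.IsAlmostControllable)
    (heven : Even (Fintype.card V) → S.charpoly.coeff 0 = 1 ∨ S.charpoly.coeff 0 = -1)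
    (hodd : Odd (Fintype.card V) → S.charpoly.coeff 1 = 1 ∨ S.charpoly.coeff 1 = -1) :
    (∀ X : Finset V, S.graph.IsBipartiteWith (X : Set V) (X : Set V)ᶜ →
      X.card ≤ Fintype.card V / 2 →
      √(S.discr : ℝ) / 2 ^ (Fintype.card V / 2) =
        ((S.block X * (S.block X).transpose).charpoly.discr : ℝ)) ∧
    (∀ k : ℤ, (k : ℝ) = √(S.discr : ℝ) / 2 ^ (Fintype.card V / 2) → Squarefree k →
      Odd k ∧ SignedGraph.IsDGS.{u, v} S) := by
  have hunit := SignedGraph.isUnit_charpoly_coeff_mod_two heven hodd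
  refine ⟨fun X hX hcard => SignedGraph.sqrt_discr_div_eq hX hcard hunit, fun k hk hsf => ?_⟩
  obtain ⟨X, hX, hcard⟩ := SignedGraph.exists_isBipartiteWith_card_le hbip
  rw [SignedGraph.sqrt_discr_div_eq hX hcard hunit, Int.cast_inj] at hk
  subst hk
  have hprime (q : ℕ) (hq : q.Prime) :
      ¬ (q : ℤ) ^ 2 ∣ (S.block X * (S.block X).transpose).charpoly.discr := fun hdvd =>
    (Nat.prime_iff_prime_int.mp hq).not_isUnit (hsf q (sq (q : ℤ) ▸ hdvd))
  refine ⟨?_, SignedGraph.isDGS_of_reflectsSqDvd hctrl fun a ha => ?_⟩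
  · rw [← Int.not_even_iff_odd, even_iff_two_dvd]
    exact not_two_dvd_discr (Matrix.charpoly_monic _) (hprime 2 Nat.prime_two)
  · exact reflectsSqDvd_of_forall_prime (Matrix.charpoly_monic _) (fun q hq =>
      SignedGraph.reflectsSqDvd_of_isBipartiteWith hX hcard hunit hq (hprime q hq)) ha
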